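/- Let $0<\alpha<1$, $l>0$, $T>0$, $r\ge 1$, let $p\in C[0,T]$ with $p\ge 0$, let $f\in C([0,l]\times[0,T])$, and let $\varphi:[0,l]\to\mathbb R$. Let $u$ be an exact solution of $$\partial_t^\alpha u-u_{xx}+p(t)u=f\ \ (0<x<l,\ 0<t\le T),\qquad u(x,0)=\varphi(x),\qquad u(0,t)=u(l,t)=0,$$ where $\partial_t^\alpha u(x,t)=\frac1{\Gamma(1-\alpha)}\int_0^t (t-s)^{-\alpha}u_s(x,s)\,ds$ is the Caputo derivative; that is, $u(\cdot,t)\in C^2[0,l]$ for every $t\in[0,T]$ (so in particular $\varphi\in C^2[0,l]$ with $\varphi(0)=\varphi(l)=0$, hence $\varphi\in H^2(0,l)\cap H^1_0(0,l)$), and for every $x\in[0,l]$ the function $u(x,\cdot)$ is continuous on $[0,T]$ and $\partial_t^\alpha u(x,\cdot)$ on $(0,T]$ extends continuously to $[0,T]$. Assume that for some constant $C_0$ and all $(x,t)\in[0,l]\times(0,T]$ the following derivatives exist and satisfy $$|\partial_x^k u(x,t)|\le C_0\quad(k=0,1,2,3,4),\qquad |\partial_t^\ell u(x,t)|\le C_0\,(1+t^{\alpha-\ell})\quad(\ell=0,1,2).$$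 For integers $N,M\ge 1$ put $h=l/N$, $x_i=ih$, $t_k=T(k/M)^r$, $\tau_k=t_k-t_{k-1}$ and $$d_{k,j}=\frac{(t_k-t_{j-1})^{1-\alpha}-(t_k-t_j)^{1-\alpha}}{\tau_j}\qquad(1\le j\le k\le M).$$ Consider the fully implicit L1 scheme for $(u_i^k)_{0\le i\le N,\,0\le k\le M}$: $$\frac1{\Gamma(2-\alpha)}\sum_{j=1}^k d_{k,j}\,(u_i^j-u_i^{j-1})-\frac{u_{i+1}^k-2u_i^k+u_{i-1}^k}{h^2}+p(t_k)\,u_i^k=f(x_i,t_k)\qquad(1\le i\le N-1,\ 1\le k\le M),$$ with $u_i^0=\varphi(x_i)$ for $0\le i\le N$ and $u_0^k=u_N^k=0$ for $0\le k\le M$. Then there is a constant $C>0$, independent of $N$ (that is, of $h$) and of $M$, such that for all $N,M\ge1$ the scheme has a solution, and every solution of it satisfies $$\max_{0\le k\le M}\ \max_{0\le i\le N}\bigl|u(x_i,t_k)-u_i^k\bigr|\ \le\ C\left(M^{-\min\{2-\alpha,\,r\alpha\}}+h^2\right).$$ -/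

import Mathlib

namespace SubdiffusionL1

noncomputable section

/-! ### The continuous problem -/

/-- Caputo derivative of order `α` of `v`, at time `t > 0`:
`Γ(1-α)⁻¹ ∫₀ᵗ v'(s) (t-s)^(-α) ds`. -/
def caputo (α : ℝ) (v : ℝ → ℝ) (t : ℝ) : ℝ :=
  (1 / Real.Gamma (1 - α)) * ∫ s in (0 : ℝ)..t, deriv v s / (t - s) ^ α

/-- `∂ₓᵏ u (x, t)` on the closed interval `[0, l]` (one-sided at the two end points). -/
def dx (l : ℝ) (u : ℝ → ℝ → ℝ) (k : ℕ) (x t : ℝ) : ℝ :=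
  iteratedDerivWithin k (fun y => u y t) (Set.Icc 0 l) x

/-- `∂ₜᵏ u (x, t)` on the half-open interval `(0, T]` (one-sided at `T`). -/
def dt (T : ℝ) (u : ℝ → ℝ → ℝ) (k : ℕ) (x t : ℝ) : ℝ :=
  iteratedDerivWithin k (fun s => u x s) (Set.Ioc 0 T) t

/-- `u` is an exact (classical) solution of the direct problem
`∂ₜ^α u - u_xx + p(t) u = f` with `u(x,0) = φ(x)` and `u(0,t) = u(l,t) = 0`. -/
structure IsExactSolution (α l T : ℝ) (p φ : ℝ → ℝ) (f u : ℝ → ℝ → ℝ) : Prop where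
  contDiff_space : ∀ t ∈ Set.Icc 0 T, ContDiffOn ℝ 2 (fun x => u x t) (Set.Icc 0 l)
  continuous_time : ∀ x ∈ Set.Icc 0 l, ContinuousOn (fun t => u x t) (Set.Icc 0 T)
  /-- The Caputo derivative is continuous up to `t = 0`; its value there is understood as the
  limit (the integral from `0` to `0` carries no information). -/
  continuous_caputo : ∀ x ∈ Set.Icc 0 l, ∃ w : ℝ → ℝ, ContinuousOn w (Set.Icc 0 T) ∧
    ∀ t ∈ Set.Ioc 0 T, caputo α (fun s => u x s) t = w t
  equation : ∀ x ∈ Set.Ioo 0 l, ∀ t ∈ Set.Ioc 0 T,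
    caputo α (fun s => u x s) t - dx l u 2 x t + p t * u x t = f x t
  initial : ∀ x ∈ Set.Icc 0 l, u x 0 = φ x
  boundary_left : ∀ t ∈ Set.Icc 0 T, u 0 t = 0
  boundary_right : ∀ t ∈ Set.Icc 0 T, u l t = 0

/-- On `[0, l] × (0, T]` the derivatives `∂ₓᵏ u`, `k ≤ 4`, and `∂ₜᵏ u`, `k ≤ 2`, exist, with
`|∂ₓᵏ u| ≤ C` and `|∂ₜᵏ u| ≤ C (1 + t^(α-k))`. Existence of the derivative of order `k + 1` is
differentiability of the one of order `k`. -/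
structure HasRegularity (α l T C : ℝ) (u : ℝ → ℝ → ℝ) : Prop where
  differentiable_space : ∀ k < 4, ∀ t ∈ Set.Ioc 0 T,
    DifferentiableOn ℝ (fun x => dx l u k x t) (Set.Icc 0 l)
  bound_space : ∀ k ≤ 4, ∀ x ∈ Set.Icc 0 l, ∀ t ∈ Set.Ioc 0 T, |dx l u k x t| ≤ C
  differentiable_time : ∀ k < 2, ∀ x ∈ Set.Icc 0 l,
    DifferentiableOn ℝ (fun t => dt T u k x t) (Set.Ioc 0 T)
  bound_time : ∀ k ≤ 2, ∀ x ∈ Set.Icc 0 l, ∀ t ∈ Set.Ioc 0 T,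
    |dt T u k x t| ≤ C * (1 + t ^ (α - (k : ℝ)))

/-! ### The scheme -/

/-- Graded time mesh `t_k = T (k/M)^r`. -/
def time (T r : ℝ) (M k : ℕ) : ℝ := T * ((k : ℝ) / (M : ℝ)) ^ r

/-- Time steps `τ_k = t_k - t_{k-1}`, for `k ≥ 1`. -/
def step (T r : ℝ) (M k : ℕ) : ℝ := time T r M k - time T r M (k - 1)

/-- Spatial mesh width `h = l / N`. -/
def width (l : ℝ) (N : ℕ) : ℝ := l / (N : ℝ)

/-- Spatial grid points `x_i = i h`. -/
def node (l : ℝ) (N i : ℕ) : ℝ := (i : ℝ) * width l N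

/-- The L1 weights `d_{k,j}`, for `1 ≤ j ≤ k`. -/
def weight (α T r : ℝ) (M k j : ℕ) : ℝ :=
  ((time T r M k - time T r M (j - 1)) ^ (1 - α) - (time T r M k - time T r M j) ^ (1 - α))
    / step T r M j

/-- The L1 approximation of the Caputo derivative at `t_k` of a sequence of values `v j` at the
times `t_j`. -/
def l1 (α T r : ℝ) (M : ℕ) (v : ℕ → ℝ) (k : ℕ) : ℝ :=
  (1 / Real.Gamma (2 - α)) * ∑ j ∈ Finset.Icc 1 k, weight α T r M k j * (v j - v (j - 1))

/-- `U k i`, standing for `u_i^k` (`0 ≤ k ≤ M`, `0 ≤ i ≤ N`), is a numerical solution: it satisfies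
the fully implicit L1 / central-difference scheme with its initial and boundary values. -/
structure IsNumericalSolution (α l T r : ℝ) (p φ : ℝ → ℝ) (f : ℝ → ℝ → ℝ) (N M : ℕ)
    (U : ℕ → ℕ → ℝ) : Prop where
  equation : ∀ k, 1 ≤ k → k ≤ M → ∀ i, 1 ≤ i → i < N →
    l1 α T r M (fun j => U j i) k
      - (U k (i + 1) - 2 * U k i + U k (i - 1)) / width l N ^ 2
      + p (time T r M k) * U k i = f (node l N i) (time T r M k)
  initial : ∀ i ≤ N, U 0 i = φ (node l N i)
  boundary_left : ∀ k ≤ M, U k 0 = 0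
  boundary_right : ∀ k ≤ M, U k N = 0

/-- `max_{0 ≤ i ≤ n} v i`. -/
def maxUpTo (n : ℕ) (v : ℕ → ℝ) : ℝ :=
  (Finset.range (n + 1)).sup' Finset.nonempty_range_add_one v

/-- Discrete maximum norm `‖v‖_∞ = max_{0 ≤ i ≤ N} |v i|`. -/
def gridNorm (N : ℕ) (v : ℕ → ℝ) : ℝ := maxUpTo N fun i => |v i|

end

end SubdiffusionL1

/-!
The scheme is stable and consistent, and both facts are measured against the same barrier: the
sequence `0, 1, 1, …`, on which the L1 operator takes the value `d_{k,1} / Γ(2 - α)`, at least a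
multiple of `t_k ^ (-α)` (`le_weight_one`).

*Stability.* The weights `d_{k,j}` increase with `j`, because they are difference quotients of a
concave function. Hence the fully implicit scheme obeys a discrete maximum principle, and a right
hand side bounded by `Q` times the barrier value produces, from zero initial and boundary values,
a grid function bounded by `Q` (`abs_le_of_abs_scheme_le`).

*Consistency.* The central difference is accurate to `O(h ^ 2)` (`abs_central_difference_sub_le`).
The L1 operator has truncation error `O(k ^ (-β))` at `t_k` for `β = min (2 - α) (r α)`
(`exists_abs_l1_sub_caputo_le`). Here the interval next to `t = 0` and the one next to `t_k` are
estimated directly. On an intermediate interval the slope of the interpolant is the mean value of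
the derivative, so the kernel `(t_k - s) ^ (-α)` may be replaced by its variation over the interval;
together with `|u_tt| ≤ A t ^ (α - 2)` and `τ_j = O(t_j / j)` this bounds the local error by an
increment of the kernel times `t_j ^ α / j ^ 2`, and the sum over the intervals telescopes.

Since `β ≤ r α`, one has `k ^ (-β) ≤ M ^ (-β) (k / M) ^ (-(r α))`, where the last factor is
`(t_k / T) ^ (-α)`, a multiple of which the barrier value exceeds. So the scheme for the error has
`Q = O(M ^ (-β) + h ^ 2)` (`add_le_mul_weight_one`), which is the rate of convergence. Solvability
is obtained one time level after the other by shooting (`exists_discrete_boundary_value`).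
-/

namespace SubdiffusionL1

open MeasureTheory

/-! ### The graded mesh -/

lemma rpow_sub_one_mul_sub_le {r a b : ℝ} (hr : 1 ≤ r) (ha : 0 ≤ a) (hb : 0 < b) (hab : a ≤ b) :
    b ^ (r - 1) * (b - a) ≤ b ^ r - a ^ r := by
  have hb' : b ^ r = b ^ (r - 1) * b := by
    rw [← Real.rpow_add_one hb.ne']; congr 1; ring
  rcases ha.eq_or_lt with rfl | ha
  · rw [hb', Real.zero_rpow (by linarith), sub_zero, sub_zero]
  · have ha' : a ^ r = a ^ (r - 1) * a := by
      rw [← Real.rpow_add_one ha.ne']; congr 1; ring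
    have h : a ^ (r - 1) ≤ b ^ (r - 1) := Real.rpow_le_rpow ha.le hab (by linarith)
    rw [hb', ha']
    nlinarith

lemma rpow_sub_rpow_sub_one_le {r b : ℝ} (hr : 1 ≤ r) (hb : 1 ≤ b) :
    b ^ r - (b - 1) ^ r ≤ r * (b ^ r / b) := by
  have hb0 : 0 < b := by linarith
  have h1 : b⁻¹ ≤ 1 := inv_le_one_of_one_le₀ hb
  have h := one_add_mul_self_le_rpow_one_add (s := -b⁻¹) (by linarith) hr
  have h2 : (b - 1) ^ r = b ^ r * (1 + -b⁻¹) ^ r := by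
    rw [← Real.mul_rpow hb0.le (by linarith)]
    congr 1; field_simp; ring
  have h3 := mul_le_mul_of_nonneg_left h (Real.rpow_nonneg hb0.le r)
  rw [h2, div_eq_mul_inv]
  nlinarith

section Mesh

variable {T r : ℝ} {M : ℕ}

lemma time_zero (hr : 1 ≤ r) : time T r M 0 = 0 := by
  simp [time, Real.zero_rpow (by linarith : r ≠ 0)]

lemma time_self (hM : 1 ≤ M) : time T r M M = T := by
  have : (M : ℝ) ≠ 0 := by positivity
  simp [time, this]

lemma time_eq (T r : ℝ) (M k : ℕ) : time T r M k = time T r M 1 * (k : ℝ) ^ r := by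
  unfold time
  rw [Real.div_rpow (by positivity) (by positivity), Real.div_rpow (by positivity) (by positivity)]
  simp
  ring

lemma time_strictMono (hT : 0 < T) (hr : 1 ≤ r) (hM : 1 ≤ M) : StrictMono (time T r M) := by
  intro a b hab
  have hM' : (0 : ℝ) < M := by positivity
  have hab' : (a : ℝ) < b := by exact_mod_cast hab
  unfold time
  gcongr

lemma time_pos (hT : 0 < T) (hr : 1 ≤ r) (hM : 1 ≤ M) {k : ℕ} (hk : 1 ≤ k) :
    0 < time T r M k := by
  have := time_strictMono hT hr hM (show 0 < k by omega)
  rwa [time_zero hr] at this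

lemma time_nonneg (hT : 0 < T) (k : ℕ) : 0 ≤ time T r M k := by
  unfold time; positivity

lemma time_le (hT : 0 < T) (hr : 1 ≤ r) (hM : 1 ≤ M) {k : ℕ} (hk : k ≤ M) :
    time T r M k ≤ T := by
  simpa [time_self hM] using (time_strictMono hT hr hM).monotone hk

lemma step_pos (hT : 0 < T) (hr : 1 ≤ r) (hM : 1 ≤ M) {k : ℕ} (hk : 1 ≤ k) :
    0 < step T r M k :=
  sub_pos.2 (time_strictMono hT hr hM (by omega))

lemma step_le (hT : 0 < T) (hr : 1 ≤ r) {k : ℕ} (hk : 1 ≤ k) :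
    step T r M k ≤ r * (time T r M k / k) := by
  have h := rpow_sub_rpow_sub_one_le hr (b := k) (by exact_mod_cast hk)
  have h1 := time_nonneg (r := r) (M := M) hT 1
  unfold step
  rw [time_eq T r M k, time_eq T r M (k - 1), Nat.cast_sub hk, Nat.cast_one]
  calc _ = time T r M 1 * ((k : ℝ) ^ r - (k - 1 : ℝ) ^ r) := by ring
    _ ≤ time T r M 1 * (r * ((k : ℝ) ^ r / k)) := by gcongr
    _ = _ := by ring

lemma time_le_two_rpow_mul (hT : 0 < T) (hr : 1 ≤ r) {k : ℕ} (hk : 2 ≤ k) :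
    time T r M k ≤ 2 ^ r * time T r M (k - 1) := by
  have h1 := time_nonneg (r := r) (M := M) hT 1
  have hk' : (2 : ℝ) ≤ k := by exact_mod_cast hk
  rw [time_eq T r M k, time_eq T r M (k - 1), Nat.cast_sub (by omega), Nat.cast_one]
  have : (k : ℝ) ^ r ≤ 2 ^ r * (k - 1 : ℝ) ^ r := by
    rw [← Real.mul_rpow (by norm_num) (by linarith)]
    gcongr; linarith
  nlinarith

/-! ### The weights of the L1 scheme -/

variable {α : ℝ}

lemma weight_pos (hα1 : α < 1) (hT : 0 < T) (hr : 1 ≤ r) (hM : 1 ≤ M) {k j : ℕ} (hj : 1 ≤ j)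
    (hjk : j ≤ k) : 0 < weight α T r M k j := by
  have hs := step_pos hT hr hM hj
  have hjk' := (time_strictMono hT hr hM).monotone hjk
  refine div_pos (sub_pos.2 (Real.rpow_lt_rpow (by linarith) ?_ (by linarith))) hs
  unfold step at hs
  linarith

/-- The weights increase towards the current time, because they are difference quotients of the
concave function `y ↦ y ^ (1 - α)` over adjacent intervals. -/
lemma weight_le_weight_succ (hα0 : 0 < α) (hα1 : α < 1) (hT : 0 < T) (hr : 1 ≤ r) (hM : 1 ≤ M)
    {k j : ℕ} (hj : 1 ≤ j) (hjk : j < k) :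
    weight α T r M k j ≤ weight α T r M k (j + 1) := by
  have hs := step_pos hT hr hM hj
  have hs' := step_pos hT hr hM (show 1 ≤ j + 1 by omega)
  have hjk' := (time_strictMono hT hr hM).monotone (show j + 1 ≤ k from hjk)
  unfold step at hs hs'
  have h := (Real.concaveOn_rpow (p := 1 - α) (by linarith) (by linarith)).slope_anti_adjacent
    (x := time T r M k - time T r M (j + 1)) (y := time T r M k - time T r M j)
    (z := time T r M k - time T r M (j - 1)) (sub_nonneg.2 hjk')
    (by rw [add_tsub_cancel_right] at hs'; rw [Set.mem_Ici]; linarith)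
    (by rw [add_tsub_cancel_right] at hs'; linarith) (by linarith)
  rw [sub_sub_sub_cancel_left, sub_sub_sub_cancel_left] at h
  simpa only [weight, step, add_tsub_cancel_right] using h

/-- The first weight is at least `(1 - α) t_k ^ (-α)`. Since it is, up to `Γ(2 - α)`, the value of
the L1 operator on the sequence `0, 1, 1, …`, this sequence is a barrier for the scheme. -/
lemma le_weight_one (hα0 : 0 < α) (hα1 : α < 1) (hT : 0 < T) (hr : 1 ≤ r) (hM : 1 ≤ M)
    {k : ℕ} (hk : 1 ≤ k) : (1 - α) * time T r M k ^ (-α) ≤ weight α T r M k 1 := by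
  have h1 := time_pos hT hr hM le_rfl
  have hk0 := time_pos hT hr hM hk
  have h1k := (time_strictMono hT hr hM).monotone hk
  set a := time T r M 1
  set b := time T r M k
  have hab : a / b ≤ 1 := (div_le_one hk0).2 h1k
  have h := rpow_one_add_le_one_add_mul_self (s := -(a / b)) (by linarith)
    (show 0 ≤ 1 - α by linarith) (by linarith)
  have hb : b ^ (1 - α) = b * b ^ (-α) := by
    rw [sub_eq_add_neg, Real.rpow_add hk0, Real.rpow_one]
  have hsub : (b - a) ^ (1 - α) = b ^ (1 - α) * (1 + -(a / b)) ^ (1 - α) := by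
    rw [← Real.mul_rpow hk0.le (by linarith)]
    congr 1; field_simp; ring
  have h3 := mul_le_mul_of_nonneg_left h (Real.rpow_nonneg hk0.le (1 - α))
  simp only [weight, step, Nat.sub_self, time_zero hr, sub_zero]
  rw [le_div_iff₀ h1, hsub]
  have h4 : b ^ (1 - α) * (a / b) = a * b ^ (-α) := by rw [hb]; field_simp
  nlinarith

end Mesh

/-! ### Stability of the scheme -/

lemma mul_sub_add_le_sum_mul_sub {d v : ℕ → ℝ} {Q : ℝ} {k : ℕ} (hk : 1 ≤ k)
    (hd : ∀ j, 1 ≤ j → j < k → d j ≤ d (j + 1)) (h0 : v 0 = 0)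
    (hv : ∀ j, 1 ≤ j → j < k → v j ≤ Q) :
    d k * (v k - Q) + d 1 * Q ≤ ∑ j ∈ Finset.Icc 1 k, d j * (v j - v (j - 1)) := by
  induction k, hk using Nat.le_induction with
  | base => simp [h0]; linarith
  | succ k hk ih =>
    have h := ih (fun j h1 h2 => hd j h1 (by omega)) (fun j h1 h2 => hv j h1 (by omega))
    rw [Finset.sum_Icc_succ_top (by omega), add_tsub_cancel_right]
    nlinarith [hd k hk (by omega), hv k hk (by omega)]

/-- Discrete comparison principle for the scheme with zero initial and boundary values. A right
hand side below `Q` times the value of the L1 operator on the barrier `0, 1, 1, …` forces the grid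
function to stay below `Q`: at a spatial maximum exceeding `Q` the difference quotient in space has
a sign, while the monotone weights make the L1 operator too large. -/
lemma le_of_scheme_le {α T r H Q : ℝ} {M N : ℕ} {P : ℕ → ℝ} {e : ℕ → ℕ → ℝ} (hα0 : 0 < α)
    (hα1 : α < 1) (hT : 0 < T) (hr : 1 ≤ r) (hM : 1 ≤ M) (hH : 0 ≤ H) (hQ : 0 ≤ Q)
    (hP : ∀ k ≤ M, 0 ≤ P k)
    (heq : ∀ k, 1 ≤ k → k ≤ M → ∀ i, 1 ≤ i → i < N →
      l1 α T r M (fun j => e j i) k - (e k (i + 1) - 2 * e k i + e k (i - 1)) / H + P k * e k i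
        ≤ 1 / Real.Gamma (2 - α) * (weight α T r M k 1 * Q))
    (h0 : ∀ i ≤ N, e 0 i = 0) (hleft : ∀ k ≤ M, e k 0 = 0) (hright : ∀ k ≤ M, e k N = 0) :
    ∀ k ≤ M, ∀ i ≤ N, e k i ≤ Q := by
  intro k
  induction k using Nat.strong_induction_on with
  | _ k ih =>
    intro hkM i hi
    rcases Nat.eq_zero_or_pos k with rfl | hk
    · rw [h0 i hi]; exact hQ
    obtain ⟨m, hm, hmax⟩ := Finset.exists_max_image (Finset.range (N + 1)) (e k) ⟨0, by simp⟩
    have hmax' : ∀ j ≤ N, e k j ≤ e k m := fun j hj => hmax j (by simp; omega)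
    have hmN : m ≤ N := by simp at hm; omega
    refine (hmax' i hi).trans (not_lt.1 fun hlt => ?_)
    have hm0 : m ≠ 0 := by rintro rfl; rw [hleft k hkM] at hlt; linarith
    have hmN' : m ≠ N := by rintro rfl; rw [hright k hkM] at hlt; linarith
    have hΓ : 0 < 1 / Real.Gamma (2 - α) := one_div_pos.2 (Real.Gamma_pos_of_pos (by linarith))
    have hsum := mul_sub_add_le_sum_mul_sub (d := weight α T r M k) (v := fun j => e j m) (Q := Q)
      hk (fun j h1 h2 => weight_le_weight_succ hα0 hα1 hT hr hM h1 h2) (h0 m hmN)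
      (fun j _ h2 => ih j h2 (by omega) m hmN)
    have hpos : 0 < weight α T r M k k * (e k m - Q) :=
      mul_pos (weight_pos hα1 hT hr hM hk le_rfl) (sub_pos.2 hlt)
    have hl1 : 1 / Real.Gamma (2 - α) * (weight α T r M k 1 * Q)
        < l1 α T r M (fun j => e j m) k := by
      unfold l1
      exact mul_lt_mul_of_pos_left (by linarith) hΓ
    have hδ : (e k (m + 1) - 2 * e k m + e k (m - 1)) / H ≤ 0 :=
      div_nonpos_of_nonpos_of_nonneg
        (by linarith [hmax' (m + 1) (by omega), hmax' (m - 1) (by omega)]) hH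
    have hPe : 0 ≤ P k * e k m := mul_nonneg (hP k hkM) (by linarith)
    linarith [heq k hk hkM m (by omega) (by omega)]

lemma l1_neg (α T r : ℝ) (M : ℕ) (v : ℕ → ℝ) (k : ℕ) :
    l1 α T r M (fun j => -v j) k = -l1 α T r M v k := by
  simp only [l1, ← mul_neg, ← Finset.sum_neg_distrib]
  congr 1
  exact Finset.sum_congr rfl fun j _ => by ring

lemma l1_sub (α T r : ℝ) (M : ℕ) (v w : ℕ → ℝ) (k : ℕ) :
    l1 α T r M (fun j => v j - w j) k = l1 α T r M v k - l1 α T r M w k := by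
  simp only [l1, ← mul_sub, ← Finset.sum_sub_distrib]
  congr 1
  exact Finset.sum_congr rfl fun j _ => by ring

lemma abs_le_of_abs_scheme_le {α T r H Q : ℝ} {M N : ℕ} {P : ℕ → ℝ} {e : ℕ → ℕ → ℝ} (hα0 : 0 < α)
    (hα1 : α < 1) (hT : 0 < T) (hr : 1 ≤ r) (hM : 1 ≤ M) (hH : 0 ≤ H) (hQ : 0 ≤ Q)
    (hP : ∀ k ≤ M, 0 ≤ P k)
    (heq : ∀ k, 1 ≤ k → k ≤ M → ∀ i, 1 ≤ i → i < N →
      |l1 α T r M (fun j => e j i) k - (e k (i + 1) - 2 * e k i + e k (i - 1)) / H + P k * e k i|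
        ≤ 1 / Real.Gamma (2 - α) * (weight α T r M k 1 * Q))
    (h0 : ∀ i ≤ N, e 0 i = 0) (hleft : ∀ k ≤ M, e k 0 = 0) (hright : ∀ k ≤ M, e k N = 0) :
    ∀ k ≤ M, ∀ i ≤ N, |e k i| ≤ Q := by
  intro k hk i hi
  refine abs_le'.2 ⟨le_of_scheme_le hα0 hα1 hT hr hM hH hQ hP
    (fun k h1 h2 i h3 h4 => (le_abs_self _).trans (heq k h1 h2 i h3 h4)) h0 hleft hright k hk i hi,
    le_of_scheme_le (e := fun k i => -e k i) hα0 hα1 hT hr hM hH hQ hP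
    (fun k h1 h2 i h3 h4 => le_trans (le_of_eq ?_) ((neg_le_abs _).trans (heq k h1 h2 i h3 h4)))
    (fun i hi => by simp [h0 i hi]) (fun k hk => by simp [hleft k hk])
    (fun k hk => by simp [hright k hk]) k hk i hi⟩
  rw [l1_neg]; ring

/-! ### Solvability of the scheme -/

lemma exists_secondOrder_recurrence (F : ℕ → ℝ → ℝ → ℝ) (a b : ℝ) :
    ∃ y : ℕ → ℝ, y 0 = a ∧ y 1 = b ∧ ∀ n, y (n + 2) = F n (y (n + 1)) (y n) := by
  let z : ℕ → ℝ × ℝ := fun n => Nat.rec (a, b) (fun n q => (q.2, F n q.2 q.1)) n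
  exact ⟨fun n => (z n).1, rfl, rfl, fun n => rfl⟩

/-- The two-point boundary value problem of one time level is solvable. The proof is by shooting:
the solution of the homogeneous recurrence with values `0, 1` is increasing, so it does not vanish
at `N` and a multiple of it corrects the value there of any particular solution. -/
lemma exists_discrete_boundary_value {c H : ℝ} (hc : 0 ≤ c) (hH : 0 < H) {N : ℕ} (hN : 1 ≤ N)
    (g : ℕ → ℝ) : ∃ v : ℕ → ℝ, v 0 = 0 ∧ v N = 0 ∧
      ∀ i, 1 ≤ i → i < N → c * v i - (v (i + 1) - 2 * v i + v (i - 1)) / H = g i := by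
  obtain ⟨y, y0, y1, hy⟩ := exists_secondOrder_recurrence (fun _ s q => (2 + c * H) * s - q) 0 1
  obtain ⟨z, z0, -, hz⟩ :=
    exists_secondOrder_recurrence (fun n s q => (2 + c * H) * s - q - H * g (n + 1)) 0 0
  have hmono : ∀ n, 0 ≤ y n ∧ y n ≤ y (n + 1) ∧ 1 ≤ y (n + 1) := by
    intro n
    induction n with
    | zero => simp [y0, y1]
    | succ n ih =>
      obtain ⟨h1, h2, h3⟩ := ih
      have := hy n
      have : 0 ≤ c * H * y (n + 1) := by positivity
      exact ⟨by linarith, by linarith, by linarith⟩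
  have hyN : y N ≠ 0 := by
    obtain ⟨n, rfl⟩ := Nat.exists_eq_add_of_le' hN
    linarith [(hmono n).2.2]
  refine ⟨fun i => z i - z N / y N * y i, by simp [y0, z0], by simp [hyN], fun i hi _ => ?_⟩
  obtain ⟨n, rfl⟩ := Nat.exists_eq_add_of_le' hi
  simp only [add_tsub_cancel_right, hy n, hz n, add_assoc, Nat.reduceAdd]
  field_simp
  ring

lemma l1_congr {α T r : ℝ} {M k : ℕ} {v w : ℕ → ℝ} (h : ∀ j ≤ k, v j = w j) :
    l1 α T r M v k = l1 α T r M w k := by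
  unfold l1
  congr 1
  refine Finset.sum_congr rfl fun j hj => ?_
  obtain ⟨-, hj⟩ := Finset.mem_Icc.1 hj
  rw [h j hj, h (j - 1) (by omega)]

lemma exists_isNumericalSolution {α l T r : ℝ} {p φ : ℝ → ℝ} {f : ℝ → ℝ → ℝ} {N M : ℕ}
    (hα1 : α < 1) (hl : 0 < l) (hT : 0 < T) (hr : 1 ≤ r) (hN : 1 ≤ N) (hM : 1 ≤ M)
    (hp0 : ∀ t ∈ Set.Icc 0 T, 0 ≤ p t) (hφ0 : φ 0 = 0) (hφl : φ l = 0) :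
    ∃ U, IsNumericalSolution α l T r p φ f N M U := by
  have hN0 : (N : ℝ) ≠ 0 := by positivity
  have hH : 0 < width l N ^ 2 := by unfold width; positivity
  have key : ∀ m ≤ M, ∃ U : ℕ → ℕ → ℝ, (∀ k, 1 ≤ k → k ≤ m → ∀ i, 1 ≤ i → i < N →
      l1 α T r M (fun j => U j i) k
        - (U k (i + 1) - 2 * U k i + U k (i - 1)) / width l N ^ 2
        + p (time T r M k) * U k i = f (node l N i) (time T r M k)) ∧
      (∀ i ≤ N, U 0 i = φ (node l N i)) ∧ (∀ k ≤ m, U k 0 = 0) ∧ (∀ k ≤ m, U k N = 0) := by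
    intro m
    induction m with
    | zero =>
      intro _
      refine ⟨fun _ i => φ (node l N i), fun k h1 h2 => by omega, fun i _ => rfl, fun k _ => ?_,
        fun k _ => ?_⟩
      · simp [node, hφ0]
      · simp [node, width, mul_div_cancel₀ _ hN0, hφl]
    | succ m ih =>
      intro hm
      obtain ⟨U, hU, hU0, hUl, hUr⟩ := ih (by omega)
      have hΓ : 0 < 1 / Real.Gamma (2 - α) :=
        one_div_pos.2 (Real.Gamma_pos_of_pos (by linarith))
      have hd := weight_pos hα1 hT hr hM (show 1 ≤ m + 1 by omega) (le_refl (m + 1))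
      have hp := hp0 _ ⟨time_nonneg (r := r) (M := M) hT (m + 1), time_le hT hr hM hm⟩
      obtain ⟨v, v0, vN, hv⟩ := exists_discrete_boundary_value
        (c := 1 / Real.Gamma (2 - α) * weight α T r M (m + 1) (m + 1) + p (time T r M (m + 1)))
        (by positivity) hH hN
        (fun i => f (node l N i) (time T r M (m + 1)) - 1 / Real.Gamma (2 - α) *
          (∑ j ∈ Finset.Icc 1 m, weight α T r M (m + 1) j * (U j i - U (j - 1) i)
            - weight α T r M (m + 1) (m + 1) * U m i))
      have hold : ∀ k ≤ m, Function.update U (m + 1) v k = U k := fun k hk =>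
        Function.update_of_ne (by omega) _ _
      refine ⟨Function.update U (m + 1) v, fun k h1 h2 i h3 h4 => ?_, fun i hi => ?_,
        fun k hk => ?_, fun k hk => ?_⟩
      · rcases Nat.lt_or_ge m k with h | h
        · obtain rfl : k = m + 1 := by omega
          have hsum : ∑ j ∈ Finset.Icc 1 m, weight α T r M (m + 1) j *
              (Function.update U (m + 1) v j i - Function.update U (m + 1) v (j - 1) i)
              = ∑ j ∈ Finset.Icc 1 m, weight α T r M (m + 1) j * (U j i - U (j - 1) i) := by
            refine Finset.sum_congr rfl fun j hj => ?_
            obtain ⟨-, hj⟩ := Finset.mem_Icc.1 hj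
            rw [hold j hj, hold (j - 1) (by omega)]
          simp only [l1]
          rw [Finset.sum_Icc_succ_top (by omega), hsum, add_tsub_cancel_right, hold m le_rfl]
          simp only [Function.update_self]
          linarith [hv i h3 h4]
        · rw [← hU k h1 h i h3 h4, hold k h]
          congr 2
          exact l1_congr fun j hj => by rw [hold j (by omega)]
      · rw [hold 0 (by omega), hU0 i hi]
      · rcases Nat.lt_or_ge m k with h | h
        · obtain rfl : k = m + 1 := by omega
          simpa using v0
        · rw [hold k h, hUl k h]
      · rcases Nat.lt_or_ge m k with h | h
        · obtain rfl : k = m + 1 := by omega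
          simpa using vN
        · rw [hold k h, hUr k h]
  obtain ⟨U, h1, h2, h3, h4⟩ := key M le_rfl
  exact ⟨U, h1, h2, h3, h4⟩

/-! ### Consistency in space -/

lemma abs_le_mul_of_hasDerivWithinAt {G G' : ℝ → ℝ} {h K : ℝ}
    (hG : ∀ s ∈ Set.Icc 0 h, HasDerivWithinAt G (G' s) (Set.Icc 0 h) s) (h0 : G 0 = 0)
    (hK : ∀ s ∈ Set.Icc 0 h, |G' s| ≤ K) (hK0 : 0 ≤ K) :
    ∀ s ∈ Set.Icc 0 h, |G s| ≤ K * h := by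
  intro s hs
  have := (convex_Icc (0 : ℝ) h).norm_image_sub_le_of_norm_hasDerivWithin_le hG
    (fun x hx => by simpa using hK x hx) ⟨le_rfl, hs.1.trans hs.2⟩ hs
  rw [h0, sub_zero, sub_zero, Real.norm_eq_abs, Real.norm_eq_abs, abs_of_nonneg hs.1] at this
  exact this.trans (mul_le_mul_of_nonneg_left hs.2 hK0)

/-- Second order consistency of the central difference. The remainder, as a function of the
width `s`, vanishes at `s = 0` together with its first three derivatives, and the third one is
bounded by the mean value theorem; continuity of the fourth derivative of `g` is not needed. -/
lemma abs_central_difference_sub_le {g₀ g₁ g₂ g₃ g₄ : ℝ → ℝ} {l C x h : ℝ}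
    (hd₀ : ∀ y ∈ Set.Icc 0 l, HasDerivWithinAt g₀ (g₁ y) (Set.Icc 0 l) y)
    (hd₁ : ∀ y ∈ Set.Icc 0 l, HasDerivWithinAt g₁ (g₂ y) (Set.Icc 0 l) y)
    (hd₂ : ∀ y ∈ Set.Icc 0 l, HasDerivWithinAt g₂ (g₃ y) (Set.Icc 0 l) y)
    (hd₃ : ∀ y ∈ Set.Icc 0 l, HasDerivWithinAt g₃ (g₄ y) (Set.Icc 0 l) y)
    (hC : ∀ y ∈ Set.Icc 0 l, |g₄ y| ≤ C) (hh : 0 < h) (hx0 : 0 ≤ x - h) (hxl : x + h ≤ l) :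
    |(g₀ (x + h) - 2 * g₀ x + g₀ (x - h)) / h ^ 2 - g₂ x| ≤ 2 * C * h ^ 2 := by
  have hplus : Set.MapsTo (fun s => x + s) (Set.Icc 0 h) (Set.Icc 0 l) := fun s hs =>
    ⟨by linarith [hs.1, hs.2], by linarith [hs.1, hs.2]⟩
  have hminus : Set.MapsTo (fun s => x - s) (Set.Icc 0 h) (Set.Icc 0 l) := fun s hs =>
    ⟨by linarith [hs.1, hs.2], by linarith [hs.1, hs.2]⟩
  have hC0 : 0 ≤ C := (abs_nonneg _).trans (hC x ⟨by linarith, by linarith⟩)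
  have dplus : ∀ {q q' : ℝ → ℝ}, (∀ y ∈ Set.Icc 0 l, HasDerivWithinAt q (q' y) (Set.Icc 0 l) y) →
      ∀ s ∈ Set.Icc 0 h, HasDerivWithinAt (fun s => q (x + s)) (q' (x + s)) (Set.Icc 0 h) s := by
    intro q q' hq s hs
    have := (hq _ (hplus hs)).comp s ((hasDerivWithinAt_id s _).const_add x) hplus
    simpa [Function.comp_def] using this
  have dminus : ∀ {q q' : ℝ → ℝ}, (∀ y ∈ Set.Icc 0 l, HasDerivWithinAt q (q' y) (Set.Icc 0 l) y) →
      ∀ s ∈ Set.Icc 0 h, HasDerivWithinAt (fun s => q (x - s)) (-q' (x - s)) (Set.Icc 0 h) s := by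
    intro q q' hq s hs
    have := (hq _ (hminus hs)).comp s ((hasDerivWithinAt_id s _).const_sub x) hminus
    simpa [Function.comp_def] using this
  have h₃ : ∀ s ∈ Set.Icc 0 h, |g₃ (x + s) - g₃ (x - s)| ≤ 2 * C * h := by
    refine abs_le_mul_of_hasDerivWithinAt (G' := fun s => g₄ (x + s) - -g₄ (x - s))
      (fun s hs => (dplus hd₃ s hs).sub (dminus hd₃ s hs)) (by simp) (fun s hs => ?_)
      (by positivity)
    have := abs_add_le (g₄ (x + s)) (g₄ (x - s))
    rw [sub_neg_eq_add]
    linarith [hC _ (hplus hs), hC _ (hminus hs)]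
  have h₂ : ∀ s ∈ Set.Icc 0 h, |g₂ (x + s) + g₂ (x - s) - 2 * g₂ x| ≤ 2 * C * h * h := by
    refine abs_le_mul_of_hasDerivWithinAt (G' := fun s => g₃ (x + s) - g₃ (x - s))
      (fun s hs => ?_) (by simp; ring) h₃ (by positivity)
    exact (((dplus hd₂ s hs).add (dminus hd₂ s hs)).sub_const (2 * g₂ x)).congr_deriv (by ring)
  have h₁ : ∀ s ∈ Set.Icc 0 h, |g₁ (x + s) - g₁ (x - s) - s * (2 * g₂ x)|
      ≤ 2 * C * h * h * h := by
    refine abs_le_mul_of_hasDerivWithinAt (G' := fun s => g₂ (x + s) + g₂ (x - s) - 2 * g₂ x)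
      (fun s hs => ?_) (by simp) h₂ (by positivity)
    exact (((dplus hd₁ s hs).sub (dminus hd₁ s hs)).sub
      ((hasDerivWithinAt_id s _).mul_const (2 * g₂ x))).congr_deriv (by ring)
  have h₀ : ∀ s ∈ Set.Icc 0 h, |g₀ (x + s) + g₀ (x - s) - s ^ 2 * g₂ x - 2 * g₀ x|
      ≤ 2 * C * h * h * h * h := by
    refine abs_le_mul_of_hasDerivWithinAt
      (G' := fun s => g₁ (x + s) - g₁ (x - s) - s * (2 * g₂ x))
      (fun s hs => ?_) (by simp; ring) h₁ (by positivity)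
    refine ((((dplus hd₀ s hs).add (dminus hd₀ s hs)).sub
      (((hasDerivWithinAt_id s _).pow 2).mul_const (g₂ x))).sub_const (2 * g₀ x)).congr_deriv ?_
    simp
    ring
  have hfin := h₀ h ⟨hh.le, le_rfl⟩
  have heq : (g₀ (x + h) - 2 * g₀ x + g₀ (x - h)) / h ^ 2 - g₂ x
      = (g₀ (x + h) + g₀ (x - h) - h ^ 2 * g₂ x - 2 * g₀ x) / h ^ 2 := by
    field_simp; ring
  rw [heq, abs_div, abs_of_pos (pow_pos hh 2), div_le_iff₀ (pow_pos hh 2)]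
  linarith

lemma hasDerivWithinAt_dx {α l T C : ℝ} {u : ℝ → ℝ → ℝ} (hreg : HasRegularity α l T C u) {k : ℕ}
    (hk : k < 4) {t : ℝ} (ht : t ∈ Set.Ioc 0 T) :
    ∀ y ∈ Set.Icc 0 l, HasDerivWithinAt (fun y => dx l u k y t) (dx l u (k + 1) y t)
      (Set.Icc 0 l) y := by
  intro y hy
  have h : dx l u (k + 1) y t = derivWithin (fun y => dx l u k y t) (Set.Icc 0 l) y :=
    congrFun iteratedDerivWithin_succ y
  rw [h]
  exact (hreg.differentiable_space k hk t ht y hy).hasDerivWithinAt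

/-! ### Quadrature error on a single interval -/

/-- The regularity in time of the solution at a fixed point of space: `w` is continuous on `[0, T]`
and twice differentiable on `(0, T)` with `|w'| ≤ A t ^ (α - 1)` and `|w''| ≤ A t ^ (α - 2)`. -/
structure HasWeakSingularity (α T A : ℝ) (w : ℝ → ℝ) : Prop where
  continuousOn : ContinuousOn w (Set.Icc 0 T)
  differentiableAt : ∀ t ∈ Set.Ioo 0 T, DifferentiableAt ℝ w t
  differentiableAt_deriv : ∀ t ∈ Set.Ioo 0 T, DifferentiableAt ℝ (deriv w) t
  abs_deriv_le : ∀ t ∈ Set.Ioo 0 T, |deriv w t| ≤ A * t ^ (α - 1)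
  abs_deriv_deriv_le : ∀ t ∈ Set.Ioo 0 T, |deriv (deriv w) t| ≤ A * t ^ (α - 2)

section Interval

variable {α T A : ℝ} {w : ℝ → ℝ}

lemma HasWeakSingularity.nonneg (hw : HasWeakSingularity α T A w) (hT : 0 < T) : 0 ≤ A := by
  have h := (abs_nonneg _).trans (hw.abs_deriv_le (T / 2) ⟨by linarith, by linarith⟩)
  exact nonneg_of_mul_nonneg_left h (Real.rpow_pos_of_pos (by linarith) _)

lemma ae_restrict_uIoc_of_forall_Ioo {a b : ℝ} (hab : a ≤ b) {q : ℝ → Prop}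
    (h : ∀ s ∈ Set.Ioo a b, q s) : ∀ᵐ s ∂volume.restrict (Set.uIoc a b), q s := by
  rw [Set.uIoc_of_le hab, ← restrict_Ioo_eq_restrict_Ioc]
  exact (ae_restrict_iff' measurableSet_Ioo).2 (Filter.Eventually.of_forall h)

lemma abs_integral_le_of_forall_Ioo {a b : ℝ} (hab : a ≤ b) {F G : ℝ → ℝ}
    (h : ∀ s ∈ Set.Ioo a b, |F s| ≤ G s) (hG : IntervalIntegrable G volume a b) :
    |∫ s in a..b, F s| ≤ ∫ s in a..b, G s := by
  rw [← Real.norm_eq_abs]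
  refine intervalIntegral.norm_integral_le_of_norm_le hab ?_ hG
  have := ae_restrict_uIoc_of_forall_Ioo hab h
  rwa [Set.uIoc_of_le hab, ae_restrict_iff' measurableSet_Ioc] at this

lemma intervalIntegrable_of_forall_Ioo {a b : ℝ} (hab : a ≤ b) {F G : ℝ → ℝ} (hF : Measurable F)
    (h : ∀ s ∈ Set.Ioo a b, |F s| ≤ G s) (hG : IntervalIntegrable G volume a b) :
    IntervalIntegrable F volume a b :=
  hG.mono_fun' hF.aestronglyMeasurable (ae_restrict_uIoc_of_forall_Ioo hab h)

lemma intervalIntegrable_kernel (hα1 : α < 1) (a b t : ℝ) :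
    IntervalIntegrable (fun s => (t - s) ^ (-α)) volume a b := by
  have := (intervalIntegral.intervalIntegrable_rpow' (a := t - a) (b := t - b)
    (show -1 < -α by linarith)).comp_sub_left t
  simpa using this

lemma integral_kernel (hα1 : α < 1) (a b t : ℝ) :
    ∫ s in a..b, (t - s) ^ (-α) = ((t - a) ^ (1 - α) - (t - b) ^ (1 - α)) / (1 - α) := by
  rw [intervalIntegral.integral_comp_sub_left (fun s => s ^ (-α)),
    integral_rpow (Or.inl (by linarith)), show -α + 1 = 1 - α by ring]

lemma integral_rpow_sub_one (hα0 : 0 < α) (t : ℝ) :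
    ∫ s in (0 : ℝ)..t, s ^ (α - 1) = t ^ α / α := by
  rw [integral_rpow (Or.inl (by linarith)), sub_add_cancel, Real.zero_rpow hα0.ne', sub_zero]

/-- On each half of `(0, t)` only one of the two factors is singular. -/
lemma rpow_mul_kernel_le (hα0 : 0 < α) (hα1 : α < 1) {s t : ℝ} (hs : s ∈ Set.Ioo 0 t) :
    s ^ (α - 1) * (t - s) ^ (-α)
      ≤ (t / 2) ^ (-α) * s ^ (α - 1) + (t / 2) ^ (α - 1) * (t - s) ^ (-α) := by
  obtain ⟨h0, ht⟩ := hs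
  have h1 : 0 ≤ s ^ (α - 1) := by positivity
  have h2 : 0 ≤ (t - s) ^ (-α) := Real.rpow_nonneg (by linarith) _
  have h3 : 0 ≤ (t / 2) ^ (-α) := Real.rpow_nonneg (by linarith) _
  have h4 : 0 ≤ (t / 2) ^ (α - 1) := Real.rpow_nonneg (by linarith) _
  rcases le_total s (t / 2) with h | h
  · have := Real.rpow_le_rpow_of_nonpos (show 0 < t / 2 by linarith)
      (show t / 2 ≤ t - s by linarith) (show -α ≤ 0 by linarith)
    nlinarith [mul_nonneg h4 h2]
  · have := Real.rpow_le_rpow_of_nonpos (show 0 < t / 2 by linarith) h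
      (show α - 1 ≤ 0 by linarith)
    nlinarith [mul_nonneg h3 h1]

lemma intervalIntegrable_majorant (hα0 : 0 < α) (hα1 : α < 1) (A t : ℝ) :
    IntervalIntegrable (fun s => A * ((t / 2) ^ (-α) * s ^ (α - 1)
      + (t / 2) ^ (α - 1) * (t - s) ^ (-α))) volume 0 t :=
  (((intervalIntegral.intervalIntegrable_rpow' (by linarith)).const_mul _).add
    ((intervalIntegrable_kernel hα1 0 t t).const_mul _)).const_mul A

lemma HasWeakSingularity.abs_deriv_mul_kernel_le (hw : HasWeakSingularity α T A w) (hα0 : 0 < α)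
    (hα1 : α < 1) {s t : ℝ} (htT : t ≤ T) (hs : s ∈ Set.Ioo 0 t) :
    |deriv w s * (t - s) ^ (-α)|
      ≤ A * ((t / 2) ^ (-α) * s ^ (α - 1) + (t / 2) ^ (α - 1) * (t - s) ^ (-α)) := by
  have hT : 0 < T := by linarith [hs.1, hs.2]
  have h2 : 0 ≤ (t - s) ^ (-α) := Real.rpow_nonneg (by linarith [hs.2]) _
  rw [abs_mul, abs_of_nonneg h2]
  calc |deriv w s| * (t - s) ^ (-α) ≤ A * s ^ (α - 1) * (t - s) ^ (-α) := by
        gcongr; exact hw.abs_deriv_le s ⟨hs.1, hs.2.trans_le htT⟩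
    _ = A * (s ^ (α - 1) * (t - s) ^ (-α)) := by ring
    _ ≤ _ := mul_le_mul_of_nonneg_left (rpow_mul_kernel_le hα0 hα1 hs) (hw.nonneg hT)

lemma HasWeakSingularity.intervalIntegrable_mul_kernel (hw : HasWeakSingularity α T A w)
    (hα0 : 0 < α) (hα1 : α < 1) {t : ℝ} (ht0 : 0 ≤ t) (htT : t ≤ T) :
    IntervalIntegrable (fun s => deriv w s * (t - s) ^ (-α)) volume 0 t :=
  intervalIntegrable_of_forall_Ioo ht0
    ((measurable_deriv w).mul ((measurable_const.sub measurable_id).pow_const _))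
    (fun _ hs => hw.abs_deriv_mul_kernel_le hα0 hα1 htT hs) (intervalIntegrable_majorant hα0 hα1 A t)

lemma HasWeakSingularity.intervalIntegrable_deriv (hw : HasWeakSingularity α T A w)
    (hα0 : 0 < α) {t : ℝ} (ht0 : 0 ≤ t) (htT : t ≤ T) :
    IntervalIntegrable (deriv w) volume 0 t :=
  intervalIntegrable_of_forall_Ioo ht0 (measurable_deriv w)
    (fun s hs => hw.abs_deriv_le s ⟨hs.1, hs.2.trans_le htT⟩)
    ((intervalIntegral.intervalIntegrable_rpow' (by linarith)).const_mul A)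

lemma HasWeakSingularity.integral_deriv (hw : HasWeakSingularity α T A w) (hα0 : 0 < α) {a b : ℝ}
    (ha : 0 ≤ a) (hab : a ≤ b) (hb : b ≤ T) : ∫ s in a..b, deriv w s = w b - w a :=
  intervalIntegral.integral_eq_sub_of_hasDerivAt_of_le hab
    (hw.continuousOn.mono (Set.Icc_subset_Icc ha hb))
    (fun s hs => (hw.differentiableAt s ⟨by linarith [hs.1], by linarith [hs.2]⟩).hasDerivAt)
    ((hw.intervalIntegrable_deriv hα0 (ha.trans hab) hb).mono_set
      (by rw [Set.uIcc_of_le hab, Set.uIcc_of_le (ha.trans hab)]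
          exact Set.Icc_subset_Icc_left ha))

lemma HasWeakSingularity.abs_sub_zero_le (hw : HasWeakSingularity α T A w) (hα0 : 0 < α) {b : ℝ}
    (hb0 : 0 ≤ b) (hb : b ≤ T) : |w b - w 0| ≤ A * (b ^ α / α) := by
  rw [← hw.integral_deriv hα0 le_rfl hb0 hb, ← integral_rpow_sub_one hα0,
    ← intervalIntegral.integral_const_mul]
  exact abs_integral_le_of_forall_Ioo hb0
    (fun s hs => hw.abs_deriv_le s ⟨hs.1, hs.2.trans_le hb⟩)
    ((intervalIntegral.intervalIntegrable_rpow' (by linarith)).const_mul A)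

lemma HasWeakSingularity.abs_slope_sub_deriv_le (hw : HasWeakSingularity α T A w) (hα1 : α < 1)
    {a b s : ℝ} (ha : 0 < a) (hb : b ≤ T) (hs : s ∈ Set.Ioo a b) :
    |(w b - w a) / (b - a) - deriv w s| ≤ A * a ^ (α - 2) * (b - a) := by
  have hab : a < b := hs.1.trans hs.2
  have hsub : ∀ x ∈ Set.Ioo a b, x ∈ Set.Ioo 0 T := fun x hx =>
    ⟨ha.trans hx.1, hx.2.trans_le hb⟩
  obtain ⟨ξ, hξ, hξ'⟩ := exists_deriv_eq_slope w hab
    (hw.continuousOn.mono (Set.Icc_subset_Icc ha.le hb))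
    (fun x hx => (hw.differentiableAt x (hsub x hx)).differentiableWithinAt)
  have hA := hw.nonneg (ha.trans (hab.trans_le hb))
  rw [← hξ']
  have h := (convex_Ioo a b).norm_image_sub_le_of_norm_deriv_le (f := deriv w)
    (C := A * a ^ (α - 2)) (fun x hx => hw.differentiableAt_deriv x (hsub x hx))
    (fun x hx => (hw.abs_deriv_deriv_le x (hsub x hx)).trans
      (mul_le_mul_of_nonneg_left
        (Real.rpow_le_rpow_of_nonpos ha hx.1.le (by linarith)) hA)) hs hξ
  refine h.trans (mul_le_mul_of_nonneg_left ?_ (by positivity))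
  exact abs_le.2 ⟨by linarith [hs.2, hξ.1], by linarith [hs.1, hξ.2]⟩

/-- On an interval away from the current time `t`, the error of replacing `g` by its mean value is
multiplied only by the variation of the kernel, since the kernel may be replaced by its difference
with the constant `(t - b) ^ (-α)`. -/
lemma abs_integral_mean_sub_mul_kernel_le (hα0 : 0 < α) {g : ℝ → ℝ} {a b t m D : ℝ}
    (hab : a < b) (hbt : b < t) (hg : IntervalIntegrable g volume a b)
    (hm : ∫ s in a..b, g s = m * (b - a)) (hD : ∀ s ∈ Set.Ioo a b, |m - g s| ≤ D) :
    |∫ s in a..b, (m - g s) * (t - s) ^ (-α)|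
      ≤ ((t - b) ^ (-α) - (t - a) ^ (-α)) * (D * (b - a)) := by
  have hi : IntervalIntegrable (fun s => m - g s) volume a b :=
    intervalIntegrable_const.sub hg
  have hK : ContinuousOn (fun s => (t - s) ^ (-α)) (Set.uIcc a b) := by
    rw [Set.uIcc_of_le hab.le]
    intro s hs
    refine ContinuousAt.continuousWithinAt (ContinuousAt.rpow_const (by fun_prop) (Or.inl ?_))
    linarith [hs.2]
  have h0 : ∫ s in a..b, (m - g s) = 0 := by
    rw [intervalIntegral.integral_sub intervalIntegrable_const hg, hm]
    simp; ring
  have heq : ∫ s in a..b, (m - g s) * (t - s) ^ (-α)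
      = ∫ s in a..b, (m - g s) * ((t - s) ^ (-α) - (t - b) ^ (-α)) := by
    simp_rw [mul_sub]
    rw [intervalIntegral.integral_sub (hi.mul_continuousOn hK) (hi.mul_const _),
      intervalIntegral.integral_mul_const, h0]
    ring
  have hD0 : 0 ≤ D := (abs_nonneg _).trans (hD ((a + b) / 2) ⟨by linarith, by linarith⟩)
  rw [heq]
  refine (abs_integral_le_of_forall_Ioo hab.le
    (G := fun _ => D * ((t - b) ^ (-α) - (t - a) ^ (-α))) (fun s hs => ?_)
    intervalIntegrable_const).trans (le_of_eq (by simp; ring))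
  have h1 := Real.rpow_le_rpow_of_nonpos (show 0 < t - b by linarith)
    (show t - b ≤ t - s by linarith [hs.2]) (show -α ≤ 0 by linarith)
  have h2 := Real.rpow_le_rpow_of_nonpos (show 0 < t - s by linarith [hs.2])
    (show t - s ≤ t - a by linarith [hs.1]) (show -α ≤ 0 by linarith)
  rw [abs_mul]
  exact mul_le_mul (hD s hs) (abs_le.2 ⟨by linarith, by linarith⟩) (abs_nonneg _) hD0

lemma abs_integral_sub_mul_kernel_le_last (hα1 : α < 1) {g : ℝ → ℝ} {a t m D : ℝ}
    (hat : a < t) (hD : ∀ s ∈ Set.Ioo a t, |m - g s| ≤ D) :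
    |∫ s in a..t, (m - g s) * (t - s) ^ (-α)| ≤ D * ((t - a) ^ (1 - α) / (1 - α)) := by
  have h := integral_kernel hα1 a t t
  rw [sub_self, Real.zero_rpow (by linarith), sub_zero] at h
  rw [← h, ← intervalIntegral.integral_const_mul]
  refine abs_integral_le_of_forall_Ioo hat.le (fun s hs => ?_)
    ((intervalIntegrable_kernel hα1 a t t).const_mul D)
  have h2 : 0 ≤ (t - s) ^ (-α) := Real.rpow_nonneg (by linarith [hs.2]) _
  rw [abs_mul, abs_of_nonneg h2]
  exact mul_le_mul_of_nonneg_right (hD s hs) h2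

lemma HasWeakSingularity.abs_integral_first_le (hw : HasWeakSingularity α T A w) (hα0 : 0 < α)
    {b t : ℝ} (hb : 0 < b) (hbt : b < t) (htT : t ≤ T) :
    |∫ s in (0 : ℝ)..b, ((w b - w 0) / (b - 0) - deriv w s) * (t - s) ^ (-α)|
      ≤ (t - b) ^ (-α) * (2 * A * (b ^ α / α)) := by
  have hA := hw.nonneg (hb.trans (hbt.trans_le htT))
  set m := (w b - w 0) / (b - 0)
  have hm : |m| * b ≤ A * (b ^ α / α) := by
    have : |m| * b = |w b - w 0| := by
      simp only [m, sub_zero, abs_div, abs_of_pos hb]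
      field_simp
    rw [this]
    exact hw.abs_sub_zero_le hα0 hb.le (by linarith)
  have hK0 : 0 ≤ (t - b) ^ (-α) := Real.rpow_nonneg (by linarith) _
  have hi : IntervalIntegrable (fun s : ℝ => A * s ^ (α - 1)) volume 0 b :=
    (intervalIntegral.intervalIntegrable_rpow' (by linarith)).const_mul A
  have hG : ∫ s in (0 : ℝ)..b, (t - b) ^ (-α) * (|m| + A * s ^ (α - 1))
      = (t - b) ^ (-α) * (|m| * b + A * (b ^ α / α)) := by
    rw [intervalIntegral.integral_const_mul,
      intervalIntegral.integral_add intervalIntegrable_const hi,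
      intervalIntegral.integral_const_mul, integral_rpow_sub_one hα0]
    simp [mul_comm]
  calc _ ≤ ∫ s in (0 : ℝ)..b, (t - b) ^ (-α) * (|m| + A * s ^ (α - 1)) := by
        refine abs_integral_le_of_forall_Ioo hb.le (fun s hs => ?_)
          ((intervalIntegrable_const.add hi).const_mul _)
        have h1 := Real.rpow_le_rpow_of_nonpos (show 0 < t - b by linarith)
          (show t - b ≤ t - s by linarith [hs.2]) (show -α ≤ 0 by linarith)
        have h2 : 0 ≤ (t - s) ^ (-α) := Real.rpow_nonneg (by linarith [hs.2]) _
        rw [abs_mul, abs_of_nonneg h2, mul_comm]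
        exact mul_le_mul h1 ((abs_sub _ _).trans (add_le_add_right
          (hw.abs_deriv_le s ⟨hs.1, by linarith [hs.2]⟩) _)) (abs_nonneg _) hK0
    _ = _ := hG
    _ ≤ _ := mul_le_mul_of_nonneg_left (by linarith) hK0

/-- On the first interval with current time its right end point, the kernel and the derivative are
both singular, and the error does not decay. -/
lemma HasWeakSingularity.abs_integral_first_self_le (hw : HasWeakSingularity α T A w)
    (hα0 : 0 < α) (hα1 : α < 1) {t : ℝ} (ht : 0 < t) (htT : t ≤ T) :
    |∫ s in (0 : ℝ)..t, ((w t - w 0) / (t - 0) - deriv w s) * (t - s) ^ (-α)|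
      ≤ A * (1 / (α * (1 - α)) + (2 ^ α / α + 2 ^ (1 - α) / (1 - α))) := by
  have hA := hw.nonneg (ht.trans_le htT)
  have hα' : 0 < 1 - α := by linarith
  have hK := integral_kernel hα1 0 t t
  rw [sub_self, Real.zero_rpow hα'.ne', sub_zero, sub_zero] at hK
  have h1 : |(w t - w 0) / (t - 0) * (t ^ (1 - α) / (1 - α))| ≤ A * (1 / (α * (1 - α))) := by
    have h := hw.abs_sub_zero_le hα0 ht.le htT
    have ht1 : t ^ (1 - α) = t / t ^ α := by rw [Real.rpow_sub ht, Real.rpow_one]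
    have hta : 0 < t ^ α := Real.rpow_pos_of_pos ht _
    rw [ht1, sub_zero, show (w t - w 0) / t * (t / t ^ α / (1 - α))
      = (w t - w 0) * (1 / (t ^ α * (1 - α))) by field_simp, abs_mul,
      abs_of_pos (show 0 < 1 / (t ^ α * (1 - α)) by positivity)]
    calc _ ≤ A * (t ^ α / α) * (1 / (t ^ α * (1 - α))) := by gcongr
      _ = _ := by field_simp
  have h2 : |∫ s in (0 : ℝ)..t, deriv w s * (t - s) ^ (-α)|
      ≤ A * (2 ^ α / α + 2 ^ (1 - α) / (1 - α)) := by
    refine (abs_integral_le_of_forall_Ioo ht.le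
      (fun s hs => hw.abs_deriv_mul_kernel_le hα0 hα1 htT hs)
      (intervalIntegrable_majorant hα0 hα1 A t)).trans (le_of_eq ?_)
    rw [intervalIntegral.integral_const_mul, intervalIntegral.integral_add
      ((intervalIntegral.intervalIntegrable_rpow' (by linarith)).const_mul _)
      ((intervalIntegrable_kernel hα1 0 t t).const_mul _), intervalIntegral.integral_const_mul,
      intervalIntegral.integral_const_mul, hK, integral_rpow_sub_one hα0,
      Real.div_rpow ht.le (by norm_num), Real.div_rpow ht.le (by norm_num),
      Real.rpow_neg ht.le, show α - 1 = -(1 - α) by ring, Real.rpow_neg ht.le,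
      Real.rpow_neg (by norm_num), Real.rpow_neg (by norm_num)]
    have := Real.rpow_pos_of_pos ht α
    have := Real.rpow_pos_of_pos ht (1 - α)
    field_simp
  simp_rw [sub_mul]
  rw [intervalIntegral.integral_sub ((intervalIntegrable_kernel hα1 0 t t).const_mul _)
    (hw.intervalIntegrable_mul_kernel hα0 hα1 ht.le htT), intervalIntegral.integral_const_mul, hK,
    mul_add]
  exact (abs_sub _ _).trans (add_le_add h1 h2)

end Interval

/-! ### Truncation error of the L1 operator -/

section Truncation

variable {α β T r A : ℝ} {M : ℕ} {w : ℝ → ℝ}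

lemma step_le_mul_time_pred_div (hT : 0 < T) (hr : 1 ≤ r) {k : ℕ} (hk : 2 ≤ k) :
    step T r M k ≤ r * 2 ^ r / k * time T r M (k - 1) := by
  calc step T r M k ≤ r * (time T r M k / k) := step_le hT hr (by omega)
    _ ≤ r * (2 ^ r * time T r M (k - 1) / k) := by
        gcongr; exact time_le_two_rpow_mul hT hr hk
    _ = _ := by ring

/-- The part of the truncation error at time `t_k` that comes from the `j`-th interval: the kernel
integrated against the difference between the slope of the interpolant and the derivative. -/
noncomputable def localError (α T r : ℝ) (M : ℕ) (w : ℝ → ℝ) (k j : ℕ) : ℝ :=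
  ∫ s in time T r M (j - 1)..time T r M j,
    ((w (time T r M j) - w (time T r M (j - 1))) / (time T r M j - time T r M (j - 1)) - deriv w s)
      * (time T r M k - s) ^ (-α)

lemma caputo_eq (α : ℝ) (w : ℝ → ℝ) {t : ℝ} (ht : 0 ≤ t) :
    caputo α w t = 1 / Real.Gamma (1 - α) * ∫ s in (0 : ℝ)..t, deriv w s * (t - s) ^ (-α) := by
  unfold caputo
  congr 1
  refine intervalIntegral.integral_congr fun s hs => ?_
  rw [Set.uIcc_of_le ht] at hs
  simp only [Real.rpow_neg (sub_nonneg.2 hs.2), div_eq_mul_inv]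

lemma HasWeakSingularity.l1_sub_caputo_eq (hw : HasWeakSingularity α T A w) (hα0 : 0 < α)
    (hα1 : α < 1) (hT : 0 < T) (hr : 1 ≤ r) (hM : 1 ≤ M) {k : ℕ} (hk : k ≤ M) :
    l1 α T r M (fun j => w (time T r M j)) k - caputo α w (time T r M k)
      = 1 / Real.Gamma (1 - α) * ∑ j ∈ Finset.Icc 1 k, localError α T r M w k j := by
  have hα' : 0 < 1 - α := by linarith
  have hmono := (time_strictMono hT hr hM).monotone
  have htk := time_nonneg (r := r) (M := M) hT k
  have hint := hw.intervalIntegrable_mul_kernel hα0 hα1 htk (time_le hT hr hM hk)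
  have hint' : ∀ j < k, IntervalIntegrable (fun s => deriv w s * (time T r M k - s) ^ (-α)) volume
      (time T r M j) (time T r M (j + 1)) := fun j hj => hint.mono_set (by
    rw [Set.uIcc_of_le (hmono (Nat.le_succ j)), Set.uIcc_of_le htk]
    exact Set.Icc_subset_Icc (time_nonneg hT j) (hmono hj))
  have hΓ : Real.Gamma (2 - α) = (1 - α) * Real.Gamma (1 - α) := by
    rw [← Real.Gamma_add_one hα'.ne']; congr 1; ring
  have hΓ0 : Real.Gamma (1 - α) ≠ 0 := (Real.Gamma_pos_of_pos hα').ne'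
  have hshift := Finset.sum_Ico_add' (fun j => ∫ s in time T r M (j - 1)..time T r M j,
    deriv w s * (time T r M k - s) ^ (-α)) 0 k 1
  simp only [add_tsub_cancel_right, zero_add, Finset.Ico_add_one_right_eq_Icc] at hshift
  rw [caputo_eq α w htk, ← time_zero (T := T) (M := M) hr,
    ← intervalIntegral.sum_integral_adjacent_intervals hint', l1, Finset.range_eq_Ico, hshift]
  simp_rw [Finset.mul_sum]
  rw [← Finset.sum_sub_distrib]
  refine Finset.sum_congr rfl fun j hj => ?_
  obtain ⟨h1, h2⟩ := Finset.mem_Icc.1 hj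
  have hs := step_pos hT hr hM h1
  have hi := hint' (j - 1) (by omega)
  rw [Nat.sub_add_cancel h1] at hi
  unfold localError
  simp_rw [sub_mul]
  rw [intervalIntegral.integral_sub ((intervalIntegrable_kernel hα1 _ _ _).const_mul _) hi,
    intervalIntegral.integral_const_mul, integral_kernel hα1, hΓ, weight]
  unfold step at *
  field_simp

/-- The error of the last interval, where the kernel is singular and the solution is smooth. -/
lemma HasWeakSingularity.abs_localError_self_le (hw : HasWeakSingularity α T A w)
    (hα1 : α < 1) (hT : 0 < T) (hr : 1 ≤ r) (hM : 1 ≤ M) {k : ℕ} (hk2 : 2 ≤ k)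
    (hk : k ≤ M) (hβ : β ≤ 2 - α) :
    |localError α T r M w k k| ≤ A * ((r * 2 ^ r) ^ (2 - α) / (1 - α)) * (k : ℝ) ^ (-β) := by
  have hA := hw.nonneg hT
  have ha := time_pos hT hr hM (show 1 ≤ k - 1 by omega)
  have hs := step_pos hT hr hM (show 1 ≤ k by omega)
  have hk0 : (0 : ℝ) < k := by positivity
  have hk1 : (1 : ℝ) ≤ k := by exact_mod_cast (show 1 ≤ k by omega)
  have h := abs_integral_sub_mul_kernel_le_last hα1
    (time_strictMono hT hr hM (show k - 1 < k by omega))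
    (fun s hs => hw.abs_slope_sub_deriv_le hα1 ha (time_le hT hr hM hk) hs)
  refine h.trans ?_
  have hstep := step_le_mul_time_pred_div (M := M) hT hr hk2
  change A * time T r M (k - 1) ^ (α - 2) * step T r M k
    * (step T r M k ^ (1 - α) / (1 - α)) ≤ _
  have h1 : time T r M (k - 1) ^ (α - 2) * (step T r M k * step T r M k ^ (1 - α))
      ≤ (r * 2 ^ r) ^ (2 - α) * (k : ℝ) ^ (-β) := by
    have e1 : step T r M k * step T r M k ^ (1 - α) = step T r M k ^ (2 - α) := by
      rw [mul_comm, ← Real.rpow_add_one hs.ne']; congr 1; ring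
    calc _ = (step T r M k / time T r M (k - 1)) ^ (2 - α) := by
          rw [e1, Real.div_rpow hs.le ha.le, show α - 2 = -(2 - α) by ring, Real.rpow_neg ha.le]
          ring
      _ ≤ (r * 2 ^ r / k) ^ (2 - α) := by
          refine Real.rpow_le_rpow (by positivity) ?_ (by linarith)
          rwa [div_le_iff₀ ha]
      _ = (r * 2 ^ r) ^ (2 - α) * (k : ℝ) ^ (-(2 - α)) := by
          rw [Real.div_rpow (by positivity) hk0.le, Real.rpow_neg hk0.le]; rfl
      _ ≤ _ := by
          gcongr
  have h2 : 0 ≤ A / (1 - α) := div_nonneg hA (by linarith)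
  calc _ = A / (1 - α) * (time T r M (k - 1) ^ (α - 2)
        * (step T r M k * step T r M k ^ (1 - α))) := by ring
    _ ≤ A / (1 - α) * ((r * 2 ^ r) ^ (2 - α) * (k : ℝ) ^ (-β)) :=
        mul_le_mul_of_nonneg_left h1 h2
    _ = _ := by ring

/-- In the first half of the mesh the kernel is comparable with `t_k ^ (-α)`. -/
lemma kernel_le_of_two_mul_le (hα0 : 0 < α) (hT : 0 < T) (hr : 1 ≤ r) (hM : 1 ≤ M) {k j : ℕ}
    (hk : 1 ≤ k) (hj : 2 * j ≤ k) :
    (time T r M k - time T r M j) ^ (-α)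
      ≤ time T r M 1 ^ (-α) * (2 ^ α * (k : ℝ) ^ (-(r * α))) := by
  have ht := time_pos hT hr hM le_rfl
  have hk0 : (0 : ℝ) < k := by positivity
  have hj' : 2 * (j : ℝ) ≤ k := by exact_mod_cast hj
  have h := rpow_sub_one_mul_sub_le hr (Nat.cast_nonneg j) hk0 (by linarith)
  have h' : (k : ℝ) ^ r / 2 ≤ (k : ℝ) ^ (r - 1) * (k - j) := by
    rw [Real.rpow_sub_one hk0.ne', div_mul_eq_mul_div, div_le_div_iff₀ two_pos hk0]
    nlinarith [Real.rpow_pos_of_pos hk0 r]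
  rw [time_eq T r M k, time_eq T r M j, ← mul_sub]
  calc _ ≤ (time T r M 1 * ((k : ℝ) ^ r / 2)) ^ (-α) :=
        Real.rpow_le_rpow_of_nonpos (by positivity)
          (mul_le_mul_of_nonneg_left (h'.trans h) ht.le) (by linarith)
    _ = _ := by
        rw [Real.mul_rpow ht.le (by positivity), Real.div_rpow (by positivity) (by norm_num),
          ← Real.rpow_mul hk0.le, Real.rpow_neg (by norm_num : (0 : ℝ) ≤ 2), mul_neg]
        field_simp

lemma kernel_pred_le (hα0 : 0 < α) (hT : 0 < T) (hr : 1 ≤ r) (hM : 1 ≤ M) {k : ℕ} (hk : 1 ≤ k) :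
    (time T r M k - time T r M (k - 1)) ^ (-α)
      ≤ time T r M 1 ^ (-α) * (k : ℝ) ^ (α - r * α) := by
  have ht := time_pos hT hr hM le_rfl
  have hk0 : (0 : ℝ) < k := by positivity
  have hk1 : (1 : ℝ) ≤ k := by exact_mod_cast hk
  have h := rpow_sub_one_mul_sub_le hr (show (0 : ℝ) ≤ k - 1 by linarith) hk0 (by linarith)
  rw [sub_sub_cancel, mul_one] at h
  rw [time_eq T r M k, time_eq T r M (k - 1), ← mul_sub, Nat.cast_sub hk, Nat.cast_one]
  calc _ ≤ (time T r M 1 * (k : ℝ) ^ (r - 1)) ^ (-α) :=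
        Real.rpow_le_rpow_of_nonpos (by positivity) (mul_le_mul_of_nonneg_left h ht.le)
          (by linarith)
    _ = _ := by
        rw [Real.mul_rpow ht.le (by positivity), ← Real.rpow_mul hk0.le]
        congr 2; ring

lemma HasWeakSingularity.abs_localError_one_le (hw : HasWeakSingularity α T A w) (hα0 : 0 < α)
    (hT : 0 < T) (hr : 1 ≤ r) (hM : 1 ≤ M) {k : ℕ} (hk2 : 2 ≤ k) (hk : k ≤ M)
    (hβ : β ≤ r * α) :
    |localError α T r M w k 1| ≤ A * (2 ^ α * 2 / α) * (k : ℝ) ^ (-β) := by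
  have hA := hw.nonneg hT
  have ht := time_pos hT hr hM le_rfl
  have hk1 : (1 : ℝ) ≤ k := by exact_mod_cast (show 1 ≤ k by omega)
  have h := hw.abs_integral_first_le hα0 ht (time_strictMono hT hr hM (show 1 < k by omega))
    (time_le hT hr hM hk)
  have hK := kernel_le_of_two_mul_le hα0 hT hr hM (show 1 ≤ k by omega) (show 2 * 1 ≤ k by omega)
  have hβ' : (k : ℝ) ^ (-(r * α)) ≤ (k : ℝ) ^ (-β) :=
    Real.rpow_le_rpow_of_exponent_le hk1 (by linarith)
  have hta := Real.rpow_pos_of_pos ht α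
  unfold localError
  rw [Nat.sub_self, time_zero hr]
  refine h.trans ?_
  calc _ ≤ time T r M 1 ^ (-α) * (2 ^ α * (k : ℝ) ^ (-β)) * (2 * A * (time T r M 1 ^ α / α)) := by
        refine mul_le_mul_of_nonneg_right (hK.trans ?_) (by positivity)
        gcongr
    _ = _ := by rw [Real.rpow_neg ht.le]; field_simp

/-- The error of an intermediate interval is an increment of a sequence in `j`, so that the sum
over `j` telescopes. The increment of the kernel carries the weight `j ^ (-α)`, which is bounded by
`1` in the first half of the mesh and by `2 ^ α k ^ (-α)` in the second; truncating the kernel at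
the level `X` of its values in the first half takes care of this without splitting the sum. -/
lemma HasWeakSingularity.abs_localError_le (hw : HasWeakSingularity α T A w) (hα0 : 0 < α)
    (hα1 : α < 1) (hT : 0 < T) (hr : 1 ≤ r) (hM : 1 ≤ M) {k j : ℕ} (hj : 2 ≤ j) (hjk : j < k)
    (hk : k ≤ M) (hβ : β ≤ 2 - α) (hβ' : β ≤ r * α) {X : ℝ}
    (hX : ∀ i, 2 * i ≤ k → (time T r M k - time T r M i) ^ (-α) ≤ X) :
    |localError α T r M w k j|
      ≤ A * (r * 2 ^ r) ^ 2 * time T r M 1 ^ α * (k : ℝ) ^ (r * α - β)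
        * ((min ((time T r M k - time T r M j) ^ (-α)) X
            + 2 ^ α * (k : ℝ) ^ (-α) * (time T r M k - time T r M j) ^ (-α))
          - (min ((time T r M k - time T r M (j - 1)) ^ (-α)) X
            + 2 ^ α * (k : ℝ) ^ (-α) * (time T r M k - time T r M (j - 1)) ^ (-α))) := by
  have hA := hw.nonneg hT
  have hmono := time_strictMono hT hr hM
  have ht := time_pos hT hr hM le_rfl
  have hpred := time_pos hT hr hM (show 1 ≤ j - 1 by omega)
  have hs := step_pos hT hr hM (show 1 ≤ j by omega)
  have hj0 : (0 : ℝ) < j := by positivity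
  have hj1 : (1 : ℝ) ≤ j := by exact_mod_cast (show 1 ≤ j by omega)
  have hk0 : (0 : ℝ) < k := by exact_mod_cast (show 0 < k by omega)
  have hjk' : (j : ℝ) ≤ k := by exact_mod_cast hjk.le
  have hTj : time T r M j ≤ T := time_le hT hr hM (by omega)
  have h1 : time T r M (j - 1) < time T r M j := hmono (by omega)
  have h2 : time T r M j < time T r M k := hmono hjk
  have hi : IntervalIntegrable (deriv w) volume (time T r M (j - 1)) (time T r M j) :=
    (hw.intervalIntegrable_deriv hα0 (time_nonneg hT j) hTj).mono_set (by
      rw [Set.uIcc_of_le h1.le, Set.uIcc_of_le (time_nonneg hT j)]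
      exact Set.Icc_subset_Icc_left hpred.le)
  have hm := hw.integral_deriv hα0 hpred.le h1.le hTj
  have h := abs_integral_mean_sub_mul_kernel_le hα0 h1 h2 hi
    (by rw [hm, div_mul_cancel₀ _ (sub_pos.2 h1).ne'])
    (fun s hs => hw.abs_slope_sub_deriv_le hα1 hpred hTj hs)
  have hKK := Real.rpow_le_rpow_of_nonpos (show 0 < time T r M k - time T r M j by linarith)
    (show time T r M k - time T r M j ≤ time T r M k - time T r M (j - 1) by linarith)
    (show -α ≤ 0 by linarith)
  refine h.trans ?_
  change _ * (A * time T r M (j - 1) ^ (α - 2) * step T r M j * step T r M j) ≤ _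
  have hXj := hX j
  set K := (time T r M k - time T r M j) ^ (-α)
  set K' := (time T r M k - time T r M (j - 1)) ^ (-α)
  have hquad : time T r M (j - 1) ^ (α - 2) * (step T r M j * step T r M j)
      ≤ (r * 2 ^ r) ^ 2 * (time T r M 1 ^ α * (j : ℝ) ^ (r * α - 2)) := by
    have hstep := step_le_mul_time_pred_div (M := M) hT hr hj
    have e : time T r M (j - 1) ^ (α - 2) * (time T r M (j - 1) * time T r M (j - 1))
        = time T r M (j - 1) ^ α := by
      rw [← pow_two, ← Real.rpow_natCast, ← Real.rpow_add hpred]; norm_num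
    calc _ ≤ time T r M (j - 1) ^ (α - 2) * ((r * 2 ^ r / j * time T r M (j - 1))
          * (r * 2 ^ r / j * time T r M (j - 1))) := by gcongr
      _ = (r * 2 ^ r) ^ 2 * (time T r M (j - 1) ^ α / (j : ℝ) ^ 2) := by rw [← e]; ring
      _ ≤ (r * 2 ^ r) ^ 2 * (time T r M j ^ α / (j : ℝ) ^ 2) := by gcongr
      _ = _ := by
        rw [time_eq T r M j, Real.mul_rpow ht.le (by positivity), ← Real.rpow_mul hj0.le,
          Real.rpow_sub hj0, Real.rpow_two]
        ring
  have hpow : (j : ℝ) ^ (r * α - 2) ≤ (k : ℝ) ^ (r * α - β) * (j : ℝ) ^ (-α) := by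
    calc (j : ℝ) ^ (r * α - 2) = (j : ℝ) ^ (r * α - β) * (j : ℝ) ^ (β - 2) := by
          rw [← Real.rpow_add hj0]; congr 1; ring
      _ ≤ _ := mul_le_mul (Real.rpow_le_rpow hj0.le hjk' (by linarith))
          (Real.rpow_le_rpow_of_exponent_le hj1 (by linarith)) (by positivity) (by positivity)
  have htel : (K - K') * (j : ℝ) ^ (-α) ≤ (min K X + 2 ^ α * (k : ℝ) ^ (-α) * K)
      - (min K' X + 2 ^ α * (k : ℝ) ^ (-α) * K') := by
    have hmin : min K' X ≤ min K X := min_le_min_right X hKK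
    have hc : 0 ≤ 2 ^ α * (k : ℝ) ^ (-α) := by positivity
    rcases le_total (2 * j) k with hle | hle
    · have hKX : K ≤ X := hXj hle
      rw [min_eq_left hKX, min_eq_left (hKK.trans hKX)]
      have : (j : ℝ) ^ (-α) ≤ 1 := Real.rpow_le_one_of_one_le_of_nonpos hj1 (by linarith)
      nlinarith [mul_nonneg hc (sub_nonneg.2 hKK)]
    · have hle' : (k : ℝ) / 2 ≤ j := by
        have : (k : ℝ) ≤ 2 * j := by exact_mod_cast hle
        linarith
      have : (j : ℝ) ^ (-α) ≤ 2 ^ α * (k : ℝ) ^ (-α) := by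
        refine (Real.rpow_le_rpow_of_nonpos (by positivity) hle'
          (show -α ≤ 0 by linarith)).trans (le_of_eq ?_)
        rw [Real.div_rpow hk0.le (by norm_num), Real.rpow_neg (by norm_num : (0 : ℝ) ≤ 2)]
        field_simp
      nlinarith [sub_nonneg.2 hKK]
  calc _ = (K - K') * A * (time T r M (j - 1) ^ (α - 2) * (step T r M j * step T r M j)) := by
        ring
    _ ≤ (K - K') * A * ((r * 2 ^ r) ^ 2 * (time T r M 1 ^ α
          * ((k : ℝ) ^ (r * α - β) * (j : ℝ) ^ (-α)))) := by
        refine mul_le_mul_of_nonneg_left (hquad.trans ?_) (mul_nonneg (sub_nonneg.2 hKK) hA)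
        gcongr
    _ = A * (r * 2 ^ r) ^ 2 * time T r M 1 ^ α * (k : ℝ) ^ (r * α - β)
          * ((K - K') * (j : ℝ) ^ (-α)) := by ring
    _ ≤ _ := mul_le_mul_of_nonneg_left htel (by positivity)

lemma sum_Icc_two_sub (F : ℕ → ℝ) {n : ℕ} (hn : 1 ≤ n) :
    ∑ j ∈ Finset.Icc 2 n, (F j - F (j - 1)) = F n - F 1 := by
  induction n, hn using Nat.le_induction with
  | base => simp
  | succ n hn ih =>
    rw [Finset.sum_Icc_succ_top (by omega), ih, add_tsub_cancel_right]; ring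

lemma HasWeakSingularity.sum_abs_localError_le (hw : HasWeakSingularity α T A w) (hα0 : 0 < α)
    (hα1 : α < 1) (hT : 0 < T) (hr : 1 ≤ r) (hM : 1 ≤ M) {k : ℕ} (hk2 : 2 ≤ k)
    (hk : k ≤ M) (hβ : β ≤ 2 - α) (hβ' : β ≤ r * α) :
    ∑ j ∈ Finset.Icc 2 (k - 1), |localError α T r M w k j|
      ≤ A * ((r * 2 ^ r) ^ 2 * (2 * 2 ^ α)) * (k : ℝ) ^ (-β) := by
  have hA := hw.nonneg hT
  have ht := time_pos hT hr hM le_rfl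
  have hta := Real.rpow_pos_of_pos ht α
  have hk0 : (0 : ℝ) < k := by exact_mod_cast (show 0 < k by omega)
  have hX : ∀ i, 2 * i ≤ k → (time T r M k - time T r M i) ^ (-α)
      ≤ time T r M 1 ^ (-α) * (2 ^ α * (k : ℝ) ^ (-(r * α))) := fun i hi =>
    kernel_le_of_two_mul_le hα0 hT hr hM (by omega) hi
  have hK := kernel_pred_le hα0 hT hr hM (show 1 ≤ k by omega)
  set X := time T r M 1 ^ (-α) * (2 ^ α * (k : ℝ) ^ (-(r * α))) with hXdef
  set F : ℕ → ℝ := fun j => min ((time T r M k - time T r M j) ^ (-α)) X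
    + 2 ^ α * (k : ℝ) ^ (-α) * (time T r M k - time T r M j) ^ (-α) with hF
  have hF1 : 0 ≤ F 1 := by
    have h1 : 0 ≤ (time T r M k - time T r M 1) ^ (-α) :=
      Real.rpow_nonneg (sub_nonneg.2 ((time_strictMono hT hr hM).monotone (by omega))) _
    have h2 : 0 ≤ X := by positivity
    exact add_nonneg (le_min h1 h2) (by positivity)
  have hFk : F (k - 1) ≤ time T r M 1 ^ (-α) * (2 * 2 ^ α * (k : ℝ) ^ (-(r * α))) := by
    have h1 : min ((time T r M k - time T r M (k - 1)) ^ (-α)) X ≤ X := min_le_right _ _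
    have h2 : 2 ^ α * (k : ℝ) ^ (-α) * (time T r M k - time T r M (k - 1)) ^ (-α)
        ≤ 2 ^ α * (k : ℝ) ^ (-α) * (time T r M 1 ^ (-α) * (k : ℝ) ^ (α - r * α)) :=
      mul_le_mul_of_nonneg_left hK (by positivity)
    have h3 : (k : ℝ) ^ (-α) * (k : ℝ) ^ (α - r * α) = (k : ℝ) ^ (-(r * α)) := by
      rw [← Real.rpow_add hk0]; congr 1; ring
    calc F (k - 1) ≤ X + 2 ^ α * (k : ℝ) ^ (-α)
          * (time T r M 1 ^ (-α) * (k : ℝ) ^ (α - r * α)) := add_le_add h1 h2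
      _ = _ := by rw [hXdef, ← h3]; ring
  have hterm : ∀ j ∈ Finset.Icc 2 (k - 1), |localError α T r M w k j|
      ≤ A * (r * 2 ^ r) ^ 2 * time T r M 1 ^ α * (k : ℝ) ^ (r * α - β) * (F j - F (j - 1)) := by
    intro j hj
    obtain ⟨h1, h2⟩ := Finset.mem_Icc.1 hj
    exact hw.abs_localError_le hα0 hα1 hT hr hM h1 (by omega) hk hβ hβ' hX
  refine (Finset.sum_le_sum hterm).trans ?_
  rw [← Finset.mul_sum, sum_Icc_two_sub F (by omega)]
  calc _ ≤ A * (r * 2 ^ r) ^ 2 * time T r M 1 ^ α * (k : ℝ) ^ (r * α - β)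
        * (time T r M 1 ^ (-α) * (2 * 2 ^ α * (k : ℝ) ^ (-(r * α)))) :=
        mul_le_mul_of_nonneg_left (by linarith) (by positivity)
    _ = A * ((r * 2 ^ r) ^ 2 * (2 * 2 ^ α))
        * ((k : ℝ) ^ (r * α - β) * (k : ℝ) ^ (-(r * α))) := by
        rw [Real.rpow_neg ht.le]; field_simp
    _ = _ := by rw [← Real.rpow_add hk0]; congr 2; ring

/-- Truncation error of the L1 operator on the graded mesh, for any order `β` not exceeding `2 - α`
and `r α`. The constant depends on `w` only through `A`. -/
lemma exists_abs_l1_sub_caputo_le (hα0 : 0 < α) (hα1 : α < 1) (hT : 0 < T) (hr : 1 ≤ r)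
    (hβ : β ≤ 2 - α) (hβ' : β ≤ r * α) (hA : 0 ≤ A) :
    ∃ C, 0 ≤ C ∧ ∀ (w : ℝ → ℝ), HasWeakSingularity α T A w → ∀ M k : ℕ, 1 ≤ k → k ≤ M →
      |l1 α T r M (fun j => w (time T r M j)) k - caputo α w (time T r M k)|
        ≤ C * (k : ℝ) ^ (-β) := by
  have hα' : 0 < 1 - α := by linarith
  have hΓ : 0 < 1 / Real.Gamma (1 - α) := one_div_pos.2 (Real.Gamma_pos_of_pos hα')
  set c₁ := 1 / (α * (1 - α)) + (2 ^ α / α + 2 ^ (1 - α) / (1 - α)) with hc₁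
  set c₂ := 2 ^ α * 2 / α with hc₂
  set c₃ := (r * 2 ^ r) ^ 2 * (2 * 2 ^ α) with hc₃
  set c₄ := (r * 2 ^ r) ^ (2 - α) / (1 - α) with hc₄
  have h₁ : 0 ≤ c₁ := by positivity
  have h₂ : 0 ≤ c₂ := by positivity
  have h₃ : 0 ≤ c₃ := by positivity
  have h₄ : 0 ≤ c₄ := by positivity
  refine ⟨1 / Real.Gamma (1 - α) * (A * (c₁ + c₂ + c₃ + c₄)), by positivity,
    fun w hw M k hk1 hk => ?_⟩
  have hM : 1 ≤ M := hk1.trans hk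
  rw [hw.l1_sub_caputo_eq hα0 hα1 hT hr hM hk, abs_mul, abs_of_pos hΓ, mul_assoc]
  refine mul_le_mul_of_nonneg_left ?_ hΓ.le
  rcases hk1.eq_or_lt with rfl | hk2
  · have h := hw.abs_integral_first_self_le hα0 hα1 (time_pos hT hr hM le_rfl)
      (time_le hT hr hM hM)
    rw [← time_zero (T := T) (M := M) hr] at h
    simp only [Finset.Icc_self, Finset.sum_singleton, Nat.cast_one, Real.one_rpow, mul_one]
    exact h.trans (mul_le_mul_of_nonneg_left (by linarith) hA)
  · have hsplit : ∑ j ∈ Finset.Icc 1 k, |localError α T r M w k j|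
        = |localError α T r M w k 1| + ∑ j ∈ Finset.Icc 2 (k - 1), |localError α T r M w k j|
          + |localError α T r M w k k| := by
      obtain ⟨n, rfl⟩ : ∃ n, k = n + 2 := ⟨k - 2, by omega⟩
      rw [Finset.sum_Icc_succ_top (by omega), show n + 2 - 1 = n + 1 by omega,
        ← Finset.add_sum_Ioc_eq_sum_Icc (show 1 ≤ n + 1 by omega)]
      rfl
    refine (Finset.abs_sum_le_sum_abs _ _).trans ?_
    rw [hsplit]
    have e₂ := hw.abs_localError_one_le hα0 hT hr hM hk2 hk hβ'
    have e₃ := hw.sum_abs_localError_le hα0 hα1 hT hr hM hk2 hk hβ hβ'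
    have e₄ := hw.abs_localError_self_le hα1 hT hr hM hk2 hk hβ
    rw [← hc₂] at e₂
    rw [← hc₃] at e₃
    rw [← hc₄] at e₄
    have : 0 ≤ A * c₁ * (k : ℝ) ^ (-β) := by positivity
    linarith

end Truncation

/-! ### Convergence -/

lemma HasRegularity.hasWeakSingularity {α l T C₀ : ℝ} {u : ℝ → ℝ → ℝ}
    (hreg : HasRegularity α l T C₀ u) (hα1 : α < 1) (hT : 0 < T) {x : ℝ}
    (hx : x ∈ Set.Icc 0 l) (hcont : ContinuousOn (fun t => u x t) (Set.Icc 0 T)) :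
    HasWeakSingularity α T (C₀ * (1 + T ^ (1 - α) + T ^ (2 - α))) (u x) := by
  have hC₀ : 0 ≤ C₀ := (abs_nonneg _).trans (hreg.bound_space 0 (by norm_num) x hx T ⟨hT, le_rfl⟩)
  have hnhds : ∀ {t}, t ∈ Set.Ioo 0 T → Set.Ioc 0 T ∈ nhds t := fun ht =>
    Filter.mem_of_superset (Ioo_mem_nhds ht.1 ht.2) Set.Ioo_subset_Ioc_self
  have hdt0 : (fun t => dt T u 0 x t) = u x := by
    funext t; simp [dt]
  have hdt1 : ∀ t ∈ Set.Ioo 0 T, dt T u 1 x t = deriv (u x) t := fun t ht => by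
    simp only [dt, iteratedDerivWithin_one]
    exact derivWithin_of_mem_nhds (hnhds ht)
  have hev : ∀ t ∈ Set.Ioo 0 T, (fun t => dt T u 1 x t) =ᶠ[nhds t] deriv (u x) := fun t ht =>
    Filter.eventuallyEq_of_mem (Ioo_mem_nhds ht.1 ht.2) hdt1
  have hdt2 : ∀ t ∈ Set.Ioo 0 T, dt T u 2 x t = deriv (deriv (u x)) t := fun t ht => by
    have h : dt T u 2 x t = derivWithin (fun t => dt T u 1 x t) (Set.Ioc 0 T) t :=
      congrFun iteratedDerivWithin_succ t
    rw [h, derivWithin_of_mem_nhds (hnhds ht), (hev t ht).deriv_eq]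
  -- The bound `1 + t ^ (α - m)` is absorbed into `t ^ (α - m)` because `t ≤ T`.
  have hbound : ∀ m : ℝ, α ≤ m → T ^ (m - α) ≤ T ^ (1 - α) + T ^ (2 - α) → ∀ t ∈ Set.Ioo 0 T,
      C₀ * (1 + t ^ (α - m)) ≤ C₀ * (1 + T ^ (1 - α) + T ^ (2 - α)) * t ^ (α - m) := by
    intro m hm hTm t ht
    have h1 : 1 ≤ T ^ (m - α) * t ^ (α - m) := by
      rw [show α - m = -(m - α) by ring, Real.rpow_neg ht.1.le, ← div_eq_mul_inv,
        one_le_div (Real.rpow_pos_of_pos ht.1 _)]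
      exact Real.rpow_le_rpow ht.1.le ht.2.le (by linarith)
    have h2 : 0 < t ^ (α - m) := Real.rpow_pos_of_pos ht.1 _
    rw [mul_assoc]
    exact mul_le_mul_of_nonneg_left (by nlinarith) hC₀
  have hT1 := Real.rpow_nonneg hT.le (1 - α)
  have hT2 := Real.rpow_nonneg hT.le (2 - α)
  refine ⟨hcont, fun t ht => ?_, fun t ht => ?_, fun t ht => ?_, fun t ht => ?_⟩
  · have h := hreg.differentiable_time 0 (by norm_num) x hx t ⟨ht.1, ht.2.le⟩
    rw [hdt0] at h
    exact h.differentiableAt (hnhds ht)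
  · have h := hreg.differentiable_time 1 (by norm_num) x hx t ⟨ht.1, ht.2.le⟩
    exact (hev t ht).differentiableAt_iff.1 (h.differentiableAt (hnhds ht))
  · have h := hreg.bound_time 1 (by norm_num) x hx t ⟨ht.1, ht.2.le⟩
    rw [hdt1 t ht, Nat.cast_one] at h
    exact h.trans (hbound 1 hα1.le (by linarith) t ht)
  · have h := hreg.bound_time 2 (by norm_num) x hx t ⟨ht.1, ht.2.le⟩
    rw [hdt2 t ht, Nat.cast_two] at h
    exact h.trans (hbound 2 (by linarith) (by linarith) t ht)

/-- The barrier controls both orders of consistency: `k ^ (-β) ≤ M ^ (-β) (k / M) ^ (-(r α))` as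
`β ≤ r α` and `k ≤ M`, and the last factor is `T ^ α t_k ^ (-α)`. -/
lemma add_le_mul_weight_one {α β T r : ℝ} {M k : ℕ} (hα0 : 0 < α) (hα1 : α < 1) (hT : 0 < T)
    (hr : 1 ≤ r) (hβ' : β ≤ r * α) (hk1 : 1 ≤ k) (hk : k ≤ M) {C₁ C₂ : ℝ}
    (hC₁ : 0 ≤ C₁) (hC₂ : 0 ≤ C₂) :
    C₁ * (k : ℝ) ^ (-β) + C₂ ≤ 1 / Real.Gamma (2 - α) * (weight α T r M k 1
      * (Real.Gamma (2 - α) * T ^ α / (1 - α) * (C₁ * (M : ℝ) ^ (-β) + C₂))) := by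
  have hα' : 0 < 1 - α := by linarith
  have hM : 1 ≤ M := hk1.trans hk
  have hΓ : 0 < Real.Gamma (2 - α) := Real.Gamma_pos_of_pos (by linarith)
  have hk0 : (0 : ℝ) < k := by positivity
  have hM0 : (0 : ℝ) < M := by positivity
  have hq0 : 0 < (k : ℝ) / M := by positivity
  have hq1 : (k : ℝ) / M ≤ 1 := (div_le_one hM0).2 (by exact_mod_cast hk)
  have hTα := Real.rpow_pos_of_pos hT α
  set q := ((k : ℝ) / M) ^ (-(r * α)) with hq
  have hw : (1 - α) * (T ^ (-α) * q) ≤ weight α T r M k 1 := by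
    have h := le_weight_one hα0 hα1 hT hr hM hk1
    rwa [time, Real.mul_rpow hT.le (by positivity), ← Real.rpow_mul hq0.le, mul_neg] at h
  have hq_one : 1 ≤ q := Real.one_le_rpow_of_pos_of_le_one_of_nonpos hq0 hq1
    (by nlinarith)
  have hkq : (k : ℝ) ^ (-β) ≤ (M : ℝ) ^ (-β) * q := by
    have h : ((k : ℝ) / M) ^ (-β) ≤ q :=
      Real.rpow_le_rpow_of_exponent_ge hq0 hq1 (by linarith)
    calc (k : ℝ) ^ (-β) = (M : ℝ) ^ (-β) * ((k : ℝ) / M) ^ (-β) := by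
          rw [← Real.mul_rpow hM0.le hq0.le, mul_div_cancel₀ _ hM0.ne']
      _ ≤ _ := by gcongr
  calc C₁ * (k : ℝ) ^ (-β) + C₂ ≤ C₁ * ((M : ℝ) ^ (-β) * q) + C₂ * q := by
        gcongr
        exact le_mul_of_one_le_right hC₂ hq_one
    _ = 1 / Real.Gamma (2 - α) * ((1 - α) * (T ^ (-α) * q)
        * (Real.Gamma (2 - α) * T ^ α / (1 - α) * (C₁ * (M : ℝ) ^ (-β) + C₂))) := by
        rw [Real.rpow_neg hT.le]; field_simp
    _ ≤ _ := by gcongr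

/-- Convergence at each grid point. The error solves the scheme with zero initial and boundary
values, and with the difference of the two consistency errors as right hand side. -/
lemma exists_abs_error_le {α l T r C₀ : ℝ} (hα0 : 0 < α) (hα1 : α < 1) (hl : 0 < l) (hT : 0 < T)
    (hr : 1 ≤ r) {p φ : ℝ → ℝ} {f u : ℝ → ℝ → ℝ} (hp0 : ∀ t ∈ Set.Icc 0 T, 0 ≤ p t)
    (hu : IsExactSolution α l T p φ f u) (hreg : HasRegularity α l T C₀ u) :
    ∃ C : ℝ, 0 < C ∧ ∀ N M : ℕ, 1 ≤ N → 1 ≤ M → ∀ U : ℕ → ℕ → ℝ,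
      IsNumericalSolution α l T r p φ f N M U → ∀ k ≤ M, ∀ i ≤ N,
        |u (node l N i) (time T r M k) - U k i|
          ≤ C * ((M : ℝ) ^ (-min (2 - α) (r * α)) + width l N ^ 2) := by
  have h0l : (0 : ℝ) ∈ Set.Icc 0 l := ⟨le_rfl, hl.le⟩
  have hC₀ : 0 ≤ C₀ :=
    (abs_nonneg _).trans (hreg.bound_space 0 (by norm_num) 0 h0l T ⟨hT, le_rfl⟩)
  set β := min (2 - α) (r * α)
  obtain ⟨C₁, hC₁, htime⟩ := exists_abs_l1_sub_caputo_le (β := β)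
    (A := C₀ * (1 + T ^ (1 - α) + T ^ (2 - α))) hα0 hα1 hT hr
    (min_le_left _ _) (min_le_right _ _) (by positivity)
  have hB : 0 < Real.Gamma (2 - α) * T ^ α / (1 - α) :=
    div_pos (mul_pos (Real.Gamma_pos_of_pos (by linarith)) (Real.rpow_pos_of_pos hT _))
      (by linarith)
  refine ⟨Real.Gamma (2 - α) * T ^ α / (1 - α) * (C₁ + 2 * C₀ + 1), by positivity,
    fun N M hN hM U hU => ?_⟩
  have hN0 : (0 : ℝ) < N := by positivity
  have hh : 0 < width l N := div_pos hl hN0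
  have hNh : (N : ℝ) * width l N = l := mul_div_cancel₀ _ hN0.ne'
  have hnode : ∀ i ≤ N, node l N i ∈ Set.Icc 0 l := fun i hi => by
    have hi' : (i : ℝ) ≤ N := by exact_mod_cast hi
    exact ⟨by unfold node; positivity, (mul_le_mul_of_nonneg_right hi' hh.le).trans_eq hNh⟩
  have htimeIcc : ∀ k ≤ M, time T r M k ∈ Set.Icc 0 T := fun k hk =>
    ⟨time_nonneg hT k, time_le hT hr hM hk⟩
  have hX : 0 ≤ (M : ℝ) ^ (-β) := by positivity
  have hY : 0 ≤ width l N ^ 2 := by positivity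
  have hQ : 0 ≤ Real.Gamma (2 - α) * T ^ α / (1 - α)
      * (C₁ * (M : ℝ) ^ (-β) + 2 * C₀ * width l N ^ 2) := by positivity
  have key : ∀ k ≤ M, ∀ i ≤ N, |u (node l N i) (time T r M k) - U k i|
      ≤ Real.Gamma (2 - α) * T ^ α / (1 - α)
        * (C₁ * (M : ℝ) ^ (-β) + 2 * C₀ * width l N ^ 2) := by
    refine abs_le_of_abs_scheme_le (e := fun k i => u (node l N i) (time T r M k) - U k i)
      (P := fun k => p (time T r M k)) hα0 hα1 hT hr hM hY hQ (fun k hk => hp0 _ (htimeIcc k hk))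
      (fun k hk1 hk i hi1 hi => ?_) (fun i hi => ?_) (fun k hk => ?_) (fun k hk => ?_)
    · refine le_trans ?_ (add_le_mul_weight_one hα0 hα1 hT hr (min_le_right _ _) hk1 hk hC₁
        (by positivity : 0 ≤ 2 * C₀ * width l N ^ 2))
      have hx := hnode i hi.le
      have ht : time T r M k ∈ Set.Ioc 0 T := ⟨time_pos hT hr hM hk1, time_le hT hr hM hk⟩
      have hxI : node l N i ∈ Set.Ioo 0 l := by
        have h1 : (1 : ℝ) ≤ i := by exact_mod_cast hi1
        have h2 : (i : ℝ) < N := by exact_mod_cast hi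
        exact ⟨by unfold node; positivity, (mul_lt_mul_of_pos_right h2 hh).trans_eq hNh⟩
      have hplus : node l N (i + 1) = node l N i + width l N := by
        simp only [node]; push_cast; ring
      have hminus : node l N (i - 1) = node l N i - width l N := by
        simp only [node]; rw [Nat.cast_sub hi1]; push_cast; ring
      have htr := htime (u (node l N i)) (hreg.hasWeakSingularity hα1 hT hx
        (hu.continuous_time _ hx)) M k hk1 hk
      have hsp := abs_central_difference_sub_le
        (hasDerivWithinAt_dx hreg (show 0 < 4 by norm_num) ht)
        (hasDerivWithinAt_dx hreg (show 1 < 4 by norm_num) ht)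
        (hasDerivWithinAt_dx hreg (show 2 < 4 by norm_num) ht)
        (hasDerivWithinAt_dx hreg (show 3 < 4 by norm_num) ht)
        (fun y hy => hreg.bound_space 4 le_rfl y hy _ ht) hh
        (x := node l N i) (by rw [← hminus]; exact (hnode (i - 1) (by omega)).1)
        (by rw [← hplus]; exact (hnode (i + 1) (by omega)).2)
      have hdx0 : ∀ y, dx l u 0 y (time T r M k) = u y (time T r M k) := fun y => by simp [dx]
      simp only [hdx0, ← hplus, ← hminus, one_add_one_eq_two] at hsp
      have heq := hu.equation _ hxI _ ht
      have hUeq := hU.equation k hk1 hk i hi1 hi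
      rw [l1_sub]
      have e : l1 α T r M (fun j => u (node l N i) (time T r M j)) k - l1 α T r M (fun j => U j i) k
          - (u (node l N (i + 1)) (time T r M k) - U k (i + 1)
              - 2 * (u (node l N i) (time T r M k) - U k i)
              + (u (node l N (i - 1)) (time T r M k) - U k (i - 1))) / width l N ^ 2
          + p (time T r M k) * (u (node l N i) (time T r M k) - U k i)
          = (l1 α T r M (fun j => u (node l N i) (time T r M j)) k
              - caputo α (u (node l N i)) (time T r M k))
            - ((u (node l N (i + 1)) (time T r M k) - 2 * u (node l N i) (time T r M k)
              + u (node l N (i - 1)) (time T r M k)) / width l N ^ 2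
              - dx l u 2 (node l N i) (time T r M k)) := by
        linear_combination heq - hUeq
      rw [e]
      exact (abs_sub _ _).trans (add_le_add htr hsp)
    · simp only [time_zero hr, hU.initial i hi, hu.initial _ (hnode i hi), sub_self]
    · have h : node l N 0 = 0 := by simp [node]
      simp only [h, hu.boundary_left _ (htimeIcc k hk), hU.boundary_left k hk, sub_self]
    · have h : node l N N = l := hNh
      simp only [h, hu.boundary_right _ (htimeIcc k hk), hU.boundary_right k hk, sub_self]
  have hfin : Real.Gamma (2 - α) * T ^ α / (1 - α)
        * (C₁ * (M : ℝ) ^ (-β) + 2 * C₀ * width l N ^ 2)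
      ≤ Real.Gamma (2 - α) * T ^ α / (1 - α) * (C₁ + 2 * C₀ + 1)
        * ((M : ℝ) ^ (-β) + width l N ^ 2) := by
    rw [mul_assoc (_ / _) (C₁ + 2 * C₀ + 1)]
    refine mul_le_mul_of_nonneg_left ?_ hB.le
    nlinarith [mul_nonneg hC₁ hY, mul_nonneg hC₀ hX]
  exact fun k hk i hi => (key k hk i hi).trans hfin

end SubdiffusionL1

theorem theorem4p2 (α l T r C₀ : ℝ) (hα0 : 0 < α) (hα1 : α < 1) (hl : 0 < l) (hT : 0 < T)
    (hr : 1 ≤ r) (p φ : ℝ → ℝ) (f u : ℝ → ℝ → ℝ)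
    (hp : ContinuousOn p (Set.Icc 0 T)) (hp0 : ∀ t ∈ Set.Icc 0 T, 0 ≤ p t)
    (hf : ContinuousOn (Function.uncurry f) (Set.Icc 0 l ×ˢ Set.Icc 0 T))
    (hu : SubdiffusionL1.IsExactSolution α l T p φ f u)
    (hreg : SubdiffusionL1.HasRegularity α l T C₀ u) :
    ∃ C : ℝ, 0 < C ∧ ∀ N M : ℕ, 1 ≤ N → 1 ≤ M →
      (∃ U : ℕ → ℕ → ℝ, SubdiffusionL1.IsNumericalSolution α l T r p φ f N M U) ∧
      ∀ U : ℕ → ℕ → ℝ, SubdiffusionL1.IsNumericalSolution α l T r p φ f N M U →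
        SubdiffusionL1.maxUpTo M (fun k => SubdiffusionL1.gridNorm N (fun i =>
            u (SubdiffusionL1.node l N i) (SubdiffusionL1.time T r M k) - U k i))
          ≤ C * ((M : ℝ) ^ (-min (2 - α) (r * α)) + SubdiffusionL1.width l N ^ 2) := by
  obtain ⟨C, hC, hbound⟩ := SubdiffusionL1.exists_abs_error_le hα0 hα1 hl hT hr hp0 hu hreg
  have h0T : (0 : ℝ) ∈ Set.Icc 0 T := ⟨le_rfl, hT.le⟩
  refine ⟨C, hC, fun N M hN hM =>
    ⟨SubdiffusionL1.exists_isNumericalSolution hα1 hl hT hr hN hM hp0 ?_ ?_, fun U hU => ?_⟩⟩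
  · rw [← hu.initial 0 ⟨le_rfl, hl.le⟩, hu.boundary_left 0 h0T]
  · rw [← hu.initial l ⟨hl.le, le_rfl⟩, hu.boundary_right 0 h0T]
  · exact Finset.sup'_le _ _ fun k hk =>
      Finset.sup'_le Finset.nonempty_range_add_one _ fun i hi =>
      hbound N M hN hM U hU k (Finset.mem_range_succ_iff.1 hk) i (Finset.mem_range_succ_iff.1 hi)
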